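/- Call a function of the form \[ \mathcal P(x_1,\dots,x_m)=\frac1Z\,\Delta_m(x)\,\det\big[h_k(x_j)\big]_{j,k=1}^m,\qquad \Delta_m(x)=\prod_{1\le j<k\le m}(x_k-x_j), \] a polynomial ensemble on $\mathbb R^m$ with functions $h_1,\dots,h_m:\mathbb R\to\mathbb R$ and normalization constant $Z\in\mathbb R\setminus\{0\}$ if the integrals $\int_{-\infty}^\infty x^{j-1}h_k(x)\,dx$, $j,k=1,\dots,m$, converge absolutely, $\mathcal P\ge 0$ on all of $\mathbb R^m$, and $\int_{\mathbb R^m}\mathcal P(x)\,dx=1$. We say that the eigenvalues of a random $m\times m$ Hermitian matrix are a polynomial ensemble with functions $h_1,\dots,h_m$ if, for some constant $Z$, the joint distribution of its unordered eigenvalues (i.e. of its eigenvalues, counted with multiplicity and listed in uniformly random order) has the density $\mathcal P$ on $\mathbb R^m$ and $\mathcal P$ is a polynomial ensemble. **Proposition.** Let $c$ be a real random variable and $v=(v_1,\dots,v_n)^t$ a complex random vector such that $c$, $\operatorname{Re}v_j$, $\operatorname{Im}v_j$ ($j=1,\dots,n$) are mutually independent normal random variables with mean zero, where $c$ has variance $1$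 and $\operatorname{Re}v_j$, $\operatorname{Im}v_j$ have variance $1/2$. Let $X$ be a random Hermitian matrix of size $n\times n$, independent of $(v,c)$, whose eigenvalues are a polynomial ensemble with functions $f_1,\dots,f_n$. Then the eigenvalues $y_1,\dots,y_{n+1}$ of \[ Y=\begin{pmatrix}X&v\\ v^*&c\end{pmatrix} \] are a polynomial ensemble with functions $g_1,\dots,g_{n+1}$; that is, they have the joint density \[ \frac1{\tilde Z_{n+1}}\,\Delta_{n+1}(y)\,\det\big[g_k(y_j)\big]_{j,k=1}^{n+1} \] for some constant $\tilde Z_{n+1}$, where \[ g_1(y)=e^{-\frac12y^2},\qquad g_{k+1}(y)=e^{-\frac12y^2}\int_0^y e^{\frac12x^2}f_k(x)\,dx,\quad k=1,\dots,n. \] -/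

import Mathlib

open MeasureTheory ProbabilityTheory

noncomputable section

namespace PolyEns

/-- The function `Z⁻¹ · Δ_n(x) · det [f_k(x_j)]_{j,k}` on `ℝⁿ`, where
`Δ_n(x) = det [x_j^{k-1}] = ∏_{j<k} (x_k - x_j)` is the Vandermonde determinant. -/
def density {n : ℕ} (f : Fin n → ℝ → ℝ) (Z : ℝ) (x : Fin n → ℝ) : ℝ :=
  Z⁻¹ * (Matrix.vandermonde x).det * (Matrix.of fun j k : Fin n => f k (x j)).det

/-- `density f Z` is a polynomial ensemble on `ℝⁿ`: the integrals `∫ x^{j-1} f_k(x) dx` converge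
for `j, k = 1, …, n`, and `density f Z` is a probability density function, that is, it is
nonnegative and has integral one (so that in particular `Z ≠ 0`). -/
structure IsPolynomialEnsemble {n : ℕ} (f : Fin n → ℝ → ℝ) (Z : ℝ) : Prop where
  integrable_moment : ∀ j k : Fin n, Integrable (fun x : ℝ => x ^ (j : ℕ) * f k x)
  nonneg : ∀ x, 0 ≤ density f Z x
  integral_eq_one : ∫ x, density f Z x = 1

/-- The joint law on `ℝⁿ` of the unordered eigenvalues (counted with multiplicity) of a random
Hermitian matrix: the law of the eigenvalues listed in a uniformly random order, i.e. the average
over all permutations of the law of the permuted list of eigenvalues. -/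
def eigenvalueLaw {Ω : Type*} [MeasurableSpace Ω] (μ : Measure Ω) {n : ℕ}
    (X : Ω → Matrix (Fin n) (Fin n) ℂ) (hX : ∀ ω, (X ω).IsHermitian) : Measure (Fin n → ℝ) :=
  (n.factorial : ENNReal)⁻¹ •
    ∑ σ : Equiv.Perm (Fin n), μ.map (fun ω i => (hX ω).eigenvalues (σ i))

/-- The eigenvalues of the random Hermitian matrix `X` are a polynomial ensemble with functions
`f_1, …, f_n`: their joint law has density `Z⁻¹ Δ_n(x) det [f_k(x_j)]` for some constant `Z`. -/
def EigenvaluesArePolynomialEnsemble {Ω : Type*} [MeasurableSpace Ω] (μ : Measure Ω) {n : ℕ}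
    (X : Ω → Matrix (Fin n) (Fin n) ℂ) (hX : ∀ ω, (X ω).IsHermitian) (f : Fin n → ℝ → ℝ) : Prop :=
  ∃ Z : ℝ, IsPolynomialEnsemble f Z ∧
    eigenvalueLaw μ X hX = volume.withDensity (fun x => ENNReal.ofReal (density f Z x))

/-- The bordered matrix `[[X, v], [v*, c]]` of size `n + 1`. -/
def extend {n : ℕ} (X : Matrix (Fin n) (Fin n) ℂ) (v : Fin n → ℂ) (c : ℝ) :
    Matrix (Fin (n + 1)) (Fin (n + 1)) ℂ :=
  Matrix.reindex finSumFinEquiv finSumFinEquiv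
    (Matrix.fromBlocks X (Matrix.replicateCol (Fin 1) v) (Matrix.replicateRow (Fin 1) (star v))
      (Matrix.of fun _ _ : Fin 1 => (c : ℂ)))

theorem extend_isHermitian {n : ℕ} {X : Matrix (Fin n) (Fin n) ℂ} (hX : X.IsHermitian)
    (v : Fin n → ℂ) (c : ℝ) : (extend X v c).IsHermitian := by
  unfold extend
  rw [Matrix.reindex_apply]
  apply Matrix.IsHermitian.submatrix
  apply Matrix.IsHermitian.fromBlocks hX
  · ext i j
    simp [Matrix.replicateCol, Matrix.replicateRow, Matrix.conjTranspose_apply]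
  · ext i j
    simp [Matrix.conjTranspose_apply]

/-- The functions `g_1(y) = e^{-y²/2}` and
`g_{k+1}(y) = e^{-y²/2} ∫_0^y e^{x²/2} f_k(x) dx` for `k = 1, …, n`. -/
def extendFun {n : ℕ} (f : Fin n → ℝ → ℝ) : Fin (n + 1) → ℝ → ℝ :=
  Fin.cons (fun y => Real.exp (-y ^ 2 / 2))
    (fun k y => Real.exp (-y ^ 2 / 2) * ∫ x in (0 : ℝ)..y, Real.exp (x ^ 2 / 2) * f k x)

end PolyEns

end

/-! Fix `X` first. Conjugating `Y` by the block matrix of a unitary that diagonalises `X` and the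
identity replaces `X` by the diagonal matrix of its eigenvalues `x` and `v` by a rotated vector,
which is again standard complex Gaussian. The characteristic polynomial of a bordered diagonal
matrix involves the border only through the squared moduli `r j`, which are independent exponential
variables of rate one (`charpoly_extend`, `complexGaussian_map_mulVec`,
`complexGaussian_map_norm_sq`).

For increasing `x`, the map from increasing spectra `y` to `(r, c)` is a bijection from the tuples
interlacing with `x` onto `r > 0`, `c` real; its inverse Jacobian data are read off from partial
fractions, and its Jacobian is `Δ(y) / Δ(x)` (`image_borderCoords`, `det_borderJacobian`). The trace
of `Y²` gives `∑ y² = ∑ x² + 2 ∑ r + c²`, so the weight `exp (-∑ r - c² / 2)` equals `exp (-∑ y² / 2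
+ ∑ x² / 2)`. Hence, given `x`, the ordered `y` has density `(2π)^(-1/2) Δ(y) / Δ(x) · exp (-∑ y² /
2 + ∑ x² / 2)` on the interlacing region (`borderMean_eq`).

Multiplied by the density of `x`, the factor `Δ(x)` cancels. What remains is a determinant
integrated over a product of intervals, that is, a determinant of integrals of `exp (x² / 2) f_k`
between consecutive `y_j`. Row differences identify it with the determinant of size `n + 1` built
from the `g_k`, the constant column coming from `g_1` (`det_extendFun`, `setLIntegral_interlace`).

Unordered eigenvalues are treated by testing permutation invariant laws on symmetric functions only.
The passage between ordered and unordered tuples contributes `(n + 1)! / n!`, so the new constant is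
`(n + 1) √(2π) Z`. The moment condition is a separate estimate by Tonelli and a Gaussian tail bound
(`integrable_moment_primitive`). -/

namespace PolyEns
open Polynomial

/-! ### Characteristic polynomials of bordered matrices -/

/-- The characteristic polynomial of a real symmetric bordered matrix whose upper left block is
diagonal with entries `x`, with squared border entries `r` and lower right entry `c`. -/
noncomputable def borderPoly {ι : Type*} [Fintype ι] [DecidableEq ι] (x r : ι → ℝ) (c : ℝ) : ℝ[X] :=
  (X - C c) * ∏ j, (X - C (x j)) -
    ∑ j, C (r j) * ∏ k ∈ Finset.univ.erase j, (X - C (x k))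

theorem eval_borderPoly {ι : Type*} [Fintype ι] [DecidableEq ι] (x r : ι → ℝ) (c t : ℝ) :
    (borderPoly x r c).eval t = (t - c) * ∏ j, (t - x j) -
      ∑ j, r j * ∏ k ∈ Finset.univ.erase j, (t - x k) := by
  simp [borderPoly, eval_prod, eval_finsetSum]

theorem eval_borderPoly_self {ι : Type*} [Fintype ι] [DecidableEq ι] (x r : ι → ℝ) (c : ℝ) (i : ι) :
    (borderPoly x r c).eval (x i) = - (r i * ∏ k ∈ Finset.univ.erase i, (x i - x k)) := by
  rw [eval_borderPoly, Finset.prod_eq_zero (Finset.mem_univ i) (by simp), mul_zero, zero_sub,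
    Finset.sum_eq_single i]
  · intro j _ hj
    rw [Finset.prod_eq_zero (i := i) (by simp [hj.symm]) (by simp), mul_zero]
  · simp

theorem borderPoly_comp_perm {ι : Type*} [Fintype ι] [DecidableEq ι] (x r : ι → ℝ) (c : ℝ)
    (σ : Equiv.Perm ι) : borderPoly (x ∘ σ) (r ∘ σ) c = borderPoly x r c := by
  unfold borderPoly
  congr 1
  · congr 1
    exact Equiv.prod_comp σ (fun j => X - C (x j))
  · rw [← Equiv.sum_comp σ fun j => C (r j) * ∏ k ∈ Finset.univ.erase j, (X - C (x k))]
    refine Finset.sum_congr rfl fun j _ => ?_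
    congr 1
    refine Finset.prod_bij (fun k _ => σ k) ?_ ?_ ?_ ?_
    · simp
    · simp
    · intro b hb
      exact ⟨σ.symm b, by simpa [Equiv.symm_apply_eq] using hb, by simp⟩
    · simp

/-- Schur complement of the diagonal block. The nonvanishing of `d` serves only to invert that
block; the next lemma needs the formula just off a finite set. -/
theorem det_arrow_of_forall_ne_zero {n : ℕ} (d : Fin n → ℂ) (hd : ∀ j, d j ≠ 0) (u w : Fin n → ℂ)
    (e : ℂ) :
    (Matrix.fromBlocks (Matrix.diagonal d) (Matrix.replicateCol (Fin 1) u)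
      (Matrix.replicateRow (Fin 1) w) (Matrix.of fun _ _ : Fin 1 => e)).det =
      e * ∏ j, d j - ∑ j, w j * u j * ∏ k ∈ Finset.univ.erase j, d k := by
  let I : Invertible (Matrix.diagonal d) := ⟨Matrix.diagonal fun j => (d j)⁻¹,
    by simp [hd], by simp [hd]⟩
  have hI : ⅟(Matrix.diagonal d) = Matrix.diagonal fun j => (d j)⁻¹ := rfl
  rw [Matrix.det_fromBlocks₁₁, Matrix.det_diagonal, hI, Matrix.det_fin_one]
  simp only [Matrix.sub_apply, Matrix.of_apply, Matrix.mul_apply, Matrix.replicateRow_apply,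
    Matrix.replicateCol_apply]
  rw [mul_sub, mul_comm, Finset.mul_sum]
  congr 1
  refine Finset.sum_congr rfl fun j _ => ?_
  have := hd j
  rw [← Finset.mul_prod_erase _ _ (Finset.mem_univ j), Finset.sum_eq_single j
    (fun i _ hij => by simp [hij]) (by simp), Matrix.diagonal_apply_eq]
  field_simp

/-- Two polynomials that agree off the finite set of the `x j` are equal, and there the arrow
determinant applies. -/
theorem charpoly_extend_diagonal {n : ℕ} (x : Fin n → ℝ) (w : Fin n → ℂ) (c : ℝ) :
    (extend (Matrix.diagonal fun j => (x j : ℂ)) w c).charpoly =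
      (borderPoly x (fun j => ‖w j‖ ^ 2) c).map (algebraMap ℝ ℂ) := by
  apply Polynomial.eq_of_infinite_eval_eq
  refine Set.Infinite.mono ?_ (Set.Finite.infinite_compl
    (Set.finite_range fun j => (x j : ℂ)))
  intro t ht
  have ht' : ∀ j, t - x j ≠ 0 := fun j h => ht ⟨j, (sub_eq_zero.1 h).symm⟩
  simp only [Set.mem_ofPred_eq]
  rw [Matrix.eval_charpoly]
  have h1 : Matrix.scalar (Fin (n + 1)) t - extend (Matrix.diagonal fun j => (x j : ℂ)) w c =
      Matrix.reindex finSumFinEquiv finSumFinEquiv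
      (Matrix.fromBlocks (Matrix.diagonal fun j => t - x j) (Matrix.replicateCol (Fin 1) (-w))
      (Matrix.replicateRow (Fin 1) (-star w)) (Matrix.of fun _ _ : Fin 1 => t - c)) := by
    rw [← Equiv.symm_apply_eq]
    ext (i | i) (j | j)
    · simp only [extend, Matrix.scalar_apply, Matrix.reindex_apply, Matrix.diagonal_apply,
        Matrix.fromBlocks_apply₁₁]
      split_ifs <;> simp_all
    · have : Fin.castAdd 1 i ≠ Fin.natAdd n j := by
        intro h; simp only [Fin.ext_iff, Fin.val_castAdd, Fin.val_natAdd] at h; omega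
      simp [extend, this]
    · have : Fin.natAdd n i ≠ Fin.castAdd 1 j := by
        intro h; simp only [Fin.ext_iff, Fin.val_castAdd, Fin.val_natAdd] at h; omega
      simp [extend, this]
    · obtain rfl : i = j := Subsingleton.elim _ _
      simp [extend]
  rw [h1, Matrix.det_reindex_self, det_arrow_of_forall_ne_zero _ ht']
  simp only [borderPoly, Polynomial.map_sub, Polynomial.map_mul, Polynomial.map_prod,
    Polynomial.map_sum, map_X, map_C, eval_sub, eval_mul, eval_X, eval_C, eval_prod, eval_finsetSum]
  congr 1
  refine Finset.sum_congr rfl fun j _ => ?_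
  congr 1
  simp [Complex.conj_mul']

/-- Conjugation by the block diagonal unitary with blocks `U` and `1` diagonalises `A`, fixes the
corner and sends the border `v` to `star U` applied to `v`. -/
theorem charpoly_extend {n : ℕ} {A : Matrix (Fin n) (Fin n) ℂ} (hA : A.IsHermitian)
    (v : Fin n → ℂ) (c : ℝ) :
    (extend A v c).charpoly = (borderPoly hA.eigenvalues
      (fun j => ‖(star (hA.eigenvectorUnitary : Matrix (Fin n) (Fin n) ℂ)).mulVec v j‖ ^ 2) c).map
        (algebraMap ℝ ℂ) := by
  set U : Matrix (Fin n) (Fin n) ℂ := hA.eigenvectorUnitary.1 with hU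
  have hUU : U * star U = 1 := Unitary.coe_mul_star_self _
  have hUU' : star U * U = 1 := Unitary.coe_star_mul_self _
  have hspec : A = U * Matrix.diagonal (fun j => (hA.eigenvalues j : ℂ)) * star U := by
    conv_lhs => rw [hA.spectral_theorem, Unitary.conjStarAlgAut_apply]
    rfl
  rw [← charpoly_extend_diagonal]
  unfold extend
  rw [Matrix.charpoly_reindex, Matrix.charpoly_reindex]
  have key : Matrix.fromBlocks A (Matrix.replicateCol (Fin 1) v)
      (Matrix.replicateRow (Fin 1) (star v)) (Matrix.of fun _ _ : Fin 1 => (c : ℂ)) =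
      (Matrix.fromBlocks U 0 0 1 * Matrix.fromBlocks
        (Matrix.diagonal (fun j => (hA.eigenvalues j : ℂ)))
        (Matrix.replicateCol (Fin 1) ((star U).mulVec v))
        (Matrix.replicateRow (Fin 1) (star ((star U).mulVec v)))
        (Matrix.of fun _ _ : Fin 1 => (c : ℂ))) * Matrix.fromBlocks (star U) 0 0 1 := by
    rw [Matrix.fromBlocks_multiply, Matrix.fromBlocks_multiply]
    simp only [Matrix.zero_mul, Matrix.mul_zero, add_zero, zero_add, Matrix.one_mul,
      Matrix.mul_one, Matrix.replicateCol_mulVec, ← Matrix.mul_assoc, hUU]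
    congr 1
    rw [Matrix.star_mulVec, Matrix.replicateRow_vecMul, ← Matrix.star_eq_conjTranspose,
      star_star, Matrix.mul_assoc, hUU, Matrix.mul_one]
  rw [key, Matrix.charpoly_mul_comm, ← Matrix.mul_assoc, Matrix.fromBlocks_multiply]
  simp [hUU', Matrix.fromBlocks_one]

/-! ### Roots up to permutation, and traces -/

/-- The multisets of roots agree, so every value has equally large fibres under `x` and `y`;
bijections between the fibres glue to a permutation. -/
theorem exists_perm_of_prod_X_sub_C_eq {ι R : Type*} [Fintype ι] [CommRing R] [IsDomain R]
    {x y : ι → R} (h : ∏ i, (X - C (x i)) = ∏ i, (X - C (y i))) :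
    ∃ σ : Equiv.Perm ι, x ∘ σ = y := by
  classical
  have h2 : Finset.univ.val.map x = Finset.univ.val.map y := by
    have := congrArg roots h
    rwa [roots_prod _ _ (by simp [Finset.prod_ne_zero_iff, X_sub_C_ne_zero]),
      roots_prod _ _ (by simp [Finset.prod_ne_zero_iff, X_sub_C_ne_zero]),
      Multiset.bind_congr (fun i _ => roots_X_sub_C _), Multiset.bind_singleton,
      Multiset.bind_congr (fun i _ => roots_X_sub_C _), Multiset.bind_singleton] at this
  have hcard : ∀ a, Fintype.card {i // y i = a} = Fintype.card {i // x i = a} := by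
    intro a
    have := congrArg (Multiset.count a) h2
    rw [Multiset.count_map, Multiset.count_map] at this
    simp only [Fintype.card_subtype]
    simp only [Finset.card_def, Finset.filter_val]
    simpa only [eq_comm] using this.symm
  refine ⟨(Equiv.sigmaFiberEquiv y).symm.trans ((Equiv.sigmaCongrRight fun a =>
    Fintype.equivOfCardEq (hcard a)).trans (Equiv.sigmaFiberEquiv x)), ?_⟩
  ext i
  simp only [Function.comp_apply, Equiv.trans_apply]
  have hs : ∀ p : (Σ a, {i // x i = a}), x (Equiv.sigmaFiberEquiv x p) = p.1 := fun p => p.2.2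
  rw [hs]
  rfl

theorem sum_eigenvalues_sq {ι : Type*} [Fintype ι] [DecidableEq ι]
    {A : Matrix ι ι ℂ} (hA : A.IsHermitian) :
    ((∑ i, hA.eigenvalues i ^ 2 : ℝ) : ℂ) = (A * A).trace := by
  set U : Matrix ι ι ℂ := hA.eigenvectorUnitary.1 with hU
  have hUU' : star U * U = 1 := Unitary.coe_star_mul_self _
  have hspec : A = U * Matrix.diagonal (fun j => (hA.eigenvalues j : ℂ)) * star U := by
    conv_lhs => rw [hA.spectral_theorem, Unitary.conjStarAlgAut_apply]
    rfl
  set D := Matrix.diagonal (fun j => (hA.eigenvalues j : ℂ)) with hD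
  have : A * A = U * (D * D * star U) := by
    rw [hspec]
    calc _ = U * D * (star U * U) * D * star U := by simp only [Matrix.mul_assoc]
      _ = _ := by rw [hUU', Matrix.mul_one]; simp only [Matrix.mul_assoc]
  rw [this, Matrix.trace_mul_comm, Matrix.mul_assoc, hUU', Matrix.mul_one, hD,
    Matrix.diagonal_mul_diagonal, Matrix.trace_diagonal]
  simp [sq]

theorem trace_submatrix_equiv {ι κ R : Type*} [Fintype ι] [Fintype κ] [AddCommMonoid R]
    (M : Matrix κ κ R) (e : ι ≃ κ) : (M.submatrix e e).trace = M.trace :=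
  Equiv.sum_comp e fun i => M i i

theorem trace_fromBlocks {ι κ R : Type*} [Fintype ι] [Fintype κ] [AddCommMonoid R]
    (A : Matrix ι ι R) (B : Matrix ι κ R) (C : Matrix κ ι R) (D : Matrix κ κ R) :
    (Matrix.fromBlocks A B C D).trace = A.trace + D.trace := by
  simp [Matrix.trace, Fintype.sum_sum_type]

theorem trace_extend {n : ℕ} (A : Matrix (Fin n) (Fin n) ℂ) (v : Fin n → ℂ) (c : ℝ) :
    (extend A v c).trace = A.trace + c := by
  rw [extend, Matrix.reindex_apply, trace_submatrix_equiv, trace_fromBlocks,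
    Matrix.trace_fin_one, Matrix.of_apply]

theorem trace_extend_mul_self {n : ℕ} (A : Matrix (Fin n) (Fin n) ℂ) (v : Fin n → ℂ) (c : ℝ) :
    (extend A v c * extend A v c).trace =
      (A * A).trace + 2 * ∑ j, star (v j) * v j + (c : ℂ) ^ 2 := by
  rw [extend, Matrix.reindex_apply, Matrix.submatrix_mul_equiv, trace_submatrix_equiv,
    Matrix.fromBlocks_multiply, trace_fromBlocks, Matrix.trace_add, Matrix.trace_add,
    Matrix.trace_mul_comm (Matrix.replicateCol _ _), Matrix.trace_fin_one, Matrix.trace_fin_one]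
  simp only [Matrix.mul_apply, Matrix.replicateRow_apply, Matrix.replicateCol_apply, Pi.star_apply,
    Matrix.of_apply, Finset.univ_unique, Finset.sum_singleton]
  ring

/-- The eigenvalues of the real symmetric bordered matrix with upper left block `diagonal x`, border
entries `√(r j)` and lower right entry `c`. -/
noncomputable def borderRoots {n : ℕ} (x r : Fin n → ℝ) (c : ℝ) : Fin (n + 1) → ℝ :=
  (extend_isHermitian (X := Matrix.diagonal fun j => (x j : ℂ))
    (by simp [Matrix.IsHermitian, Matrix.diagonal_conjTranspose, Pi.star_def])
      (fun j => (√(r j) : ℂ)) c).eigenvalues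

theorem prod_borderRoots {n : ℕ} (x : Fin n → ℝ) {r : Fin n → ℝ} (hr : ∀ j, 0 ≤ r j) (c : ℝ) :
    ∏ k, (X - C (borderRoots x r c k)) = borderPoly x r c := by
  apply Polynomial.map_injective (algebraMap ℝ ℂ) (algebraMap ℝ ℂ).injective
  have h := charpoly_extend_diagonal x (fun j => (√(r j) : ℂ)) c
  have h2 : (fun j => ‖((√(r j) : ℝ) : ℂ)‖ ^ 2) = r := by
    ext j
    simp [Real.sq_sqrt (hr j)]
  rw [h2] at h
  rw [← h, Matrix.IsHermitian.charpoly_eq, Polynomial.map_prod]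
  · simp only [Polynomial.map_sub, map_X, map_C]
    rfl

theorem sum_borderRoots {n : ℕ} (x r : Fin n → ℝ) (c : ℝ) :
    ∑ k, borderRoots x r c k = ∑ j, x j + c := by
  have h := (extend_isHermitian (X := Matrix.diagonal fun j => (x j : ℂ))
    (by simp [Matrix.IsHermitian, Matrix.diagonal_conjTranspose, Pi.star_def])
      (fun j => (√(r j) : ℂ)) c).trace_eq_sum_eigenvalues
  rw [trace_extend, Matrix.trace_diagonal] at h
  apply Complex.ofReal_injective
  push_cast
  exact h.symm

/-- The trace of the square. This identity is what turns the exponential and Gaussian weights of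
`(r, c)` into a Gaussian weight in the eigenvalues. -/
theorem sum_borderRoots_sq {n : ℕ} (x : Fin n → ℝ) {r : Fin n → ℝ} (hr : ∀ j, 0 ≤ r j) (c : ℝ) :
    ∑ k, borderRoots x r c k ^ 2 = ∑ j, x j ^ 2 + 2 * ∑ j, r j + c ^ 2 := by
  have h := sum_eigenvalues_sq
    (extend_isHermitian (X := Matrix.diagonal fun j => (x j : ℂ))
    (by simp [Matrix.IsHermitian, Matrix.diagonal_conjTranspose, Pi.star_def])
      (fun j => (√(r j) : ℂ)) c)
  rw [trace_extend_mul_self, Matrix.diagonal_mul_diagonal, Matrix.trace_diagonal] at h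
  apply Complex.ofReal_injective
  refine Eq.trans h ?_
  have h2 : ∀ j, ((√(r j) : ℝ) : ℂ) * ((√(r j) : ℝ) : ℂ) = r j := fun j => by
    rw [← Complex.ofReal_mul, Real.mul_self_sqrt (hr j)]
  simp only [RCLike.star_def, Complex.conj_ofReal, h2]
  push_cast
  simp only [sq]

/-! ### Measurability of the eigenvalues -/

/-- By Lusin–Souslin, a continuous injection of the Polish space of decreasing tuples is a
measurable embedding. It is applied to the values of the characteristic polynomial at the natural
numbers, which are polynomial in the matrix entries. -/
theorem measurable_eigenvalues {T : Type*} [MeasurableSpace T] {n : ℕ}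
    {M : T → Matrix (Fin n) (Fin n) ℂ} (hM : ∀ t, (M t).IsHermitian)
    (hm : ∀ i j, Measurable fun t => M t i j) :
    Measurable fun t => (hM t).eigenvalues := by
  let S := {y : Fin (Fintype.card (Fin n)) → ℝ // Antitone y}
  let e : T → S := fun t => ⟨(hM t).eigenvalues₀, (hM t).eigenvalues₀_antitone⟩
  suffices h : Measurable e by
    have h2 : Measurable fun t => (hM t).eigenvalues₀ := measurable_subtype_coe.comp h
    exact measurable_pi_lambda _ fun i => (measurable_pi_apply _).comp h2
  have hclosed : IsClosed {y : Fin (Fintype.card (Fin n)) → ℝ | Antitone y} := by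
    simp only [Antitone, Set.ofPred_forall]
    exact isClosed_iInter fun i => isClosed_iInter fun j => isClosed_iInter fun _ =>
      isClosed_le (continuous_apply _) (continuous_apply _)
  have : PolishSpace S := hclosed.polishSpace
  have : BorelSpace S := Subtype.borelSpace _
  let P : S → ℕ → ℂ := fun y k => ∏ i, ((k : ℂ) - ((y.1 i : ℝ) : ℂ))
  have hPc : Continuous P := by
    refine continuous_pi fun k => continuous_finsetProd _ fun i _ => ?_
    exact continuous_const.sub (Complex.continuous_ofReal.comp
      ((continuous_apply i).comp continuous_subtype_val))
  have hPi : Function.Injective P := by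
    intro y z h
    have h1 : ∏ i, (X - C ((y.1 i : ℝ) : ℂ)) = ∏ i, (X - C ((z.1 i : ℝ) : ℂ)) := by
      apply Polynomial.eq_of_infinite_eval_eq
      refine Set.Infinite.mono ?_ (Set.infinite_range_of_injective (Nat.cast_injective (R := ℂ)))
      rintro _ ⟨k, rfl⟩
      simpa [eval_prod, P] using congrFun h k
    obtain ⟨σ, hσ⟩ := exists_perm_of_prod_X_sub_C_eq h1
    have hσ' : y.1 ∘ σ = z.1 := by
      ext i
      exact Complex.ofReal_injective (congrFun hσ i)
    apply Subtype.ext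
    rw [← hσ']
    -- The tuples are decreasing, hence monotone with values in the order dual.
    exact Tuple.unique_monotone (α := ℝᵒᵈ) (f := y.1) (σ := 1) (τ := σ)
      (fun i j hij => y.2 hij) (fun i j hij => by
        have := z.2 hij
        rw [← hσ'] at this
        exact this)
  have hP := hPc.measurableEmbedding hPi
  rw [← hP.measurable_comp_iff]
  refine measurable_pi_lambda _ fun k => ?_
  have : ∀ t, (P ∘ e) t k = (Matrix.scalar (Fin n) (k : ℂ) - M t).det := by
    intro t
    rw [← Matrix.eval_charpoly, (hM t).charpoly_eq, eval_prod]
    simp only [eval_sub, eval_X, eval_C]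
    exact (Fintype.prod_equiv (Fintype.equivOfCardEq (Fintype.card_fin _)) _ _
      fun i => by simp [Matrix.IsHermitian.eigenvalues, e])
  simp only [this, Matrix.det_apply]
  refine Finset.measurable_fun_sum _ fun σ _ => Measurable.const_smul
    (Finset.measurable_fun_prod _ fun i _ => ?_) _
  exact measurable_const.sub (hm _ _)

/-! ### Symmetric functions of the eigenvalues -/

/-- A function of a tuple is symmetric if it is invariant under permutations of the entries. -/
def IsSymmFun {ι α β : Type*} (φ : (ι → α) → β) : Prop :=
  ∀ (σ : Equiv.Perm ι) (x : ι → α), φ (x ∘ σ) = φ x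

theorem IsSymmFun.eq_of_prod_eq {ι β : Type*} [Fintype ι] {φ : (ι → ℝ) → β} (hφ : IsSymmFun φ)
    {x y : ι → ℝ} (h : ∏ i, (X - C (x i)) = ∏ i, (X - C (y i))) : φ x = φ y := by
  obtain ⟨σ, rfl⟩ := exists_perm_of_prod_X_sub_C_eq h
  exact (hφ σ x).symm

theorem IsSymmFun.eigenvalues_extend {n : ℕ} {β : Type*} {φ : (Fin (n + 1) → ℝ) → β}
    (hφ : IsSymmFun φ) {A : Matrix (Fin n) (Fin n) ℂ} (hA : A.IsHermitian) (v : Fin n → ℂ) (c : ℝ) :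
    φ (extend_isHermitian hA v c).eigenvalues = φ (borderRoots hA.eigenvalues
      (fun j => ‖(star (hA.eigenvectorUnitary : Matrix (Fin n) (Fin n) ℂ)).mulVec v j‖ ^ 2) c) := by
  apply hφ.eq_of_prod_eq
  apply Polynomial.map_injective (algebraMap ℝ ℂ) (algebraMap ℝ ℂ).injective
  rw [prod_borderRoots _ (fun j => by positivity), ← charpoly_extend hA v c,
    Matrix.IsHermitian.charpoly_eq (extend_isHermitian hA v c), Polynomial.map_prod]
  simp only [Polynomial.map_sub, map_X, map_C]

theorem IsSymmFun.borderRoots_comp_perm {n : ℕ} {β : Type*} {φ : (Fin (n + 1) → ℝ) → β}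
    (hφ : IsSymmFun φ) (x r : Fin n → ℝ) (c : ℝ) (σ : Equiv.Perm (Fin n)) :
    φ (borderRoots (x ∘ σ) (r ∘ σ) c) = φ (borderRoots x r c) := by
  -- No sign is assumed on `r`; `√(r j) ^ 2` is the squared border entry in every case.
  have h : ∀ x r : Fin n → ℝ,
      ∏ k, (X - C (borderRoots x r c k)) = borderPoly x (fun j => √(r j) ^ 2) c := fun x r => by
    rw [← prod_borderRoots _ fun j => sq_nonneg _]
    simp [borderRoots]
  apply hφ.eq_of_prod_eq
  rw [h, h]
  exact borderPoly_comp_perm x (fun j => √(r j) ^ 2) c σ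

theorem measurable_extend_apply {n : ℕ} {T : Type*} [MeasurableSpace T]
    {A : T → Matrix (Fin n) (Fin n) ℂ} {v : T → Fin n → ℂ} {c : T → ℝ}
    (hA : ∀ i j, Measurable fun t => A t i j) (hv : Measurable v) (hc : Measurable c)
    (i j : Fin (n + 1)) : Measurable fun t => extend (A t) (v t) (c t) i j := by
  unfold extend
  simp only [Matrix.reindex_apply, Matrix.submatrix_apply]
  rcases finSumFinEquiv.symm i with i | i <;> rcases finSumFinEquiv.symm j with j | j
  · simpa using hA i j
  · simp only [Matrix.fromBlocks_apply₁₂, Matrix.replicateCol_apply]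
    fun_prop
  · simp only [Matrix.fromBlocks_apply₂₁, Matrix.replicateRow_apply, Pi.star_apply,
      RCLike.star_def]
    exact Complex.continuous_conj.measurable.comp (by fun_prop)
  · simp only [Matrix.fromBlocks_apply₂₂, Matrix.of_apply]
    fun_prop

theorem measurable_borderRoots {n : ℕ} : Measurable
    fun p : (Fin n → ℝ) × (Fin n → ℝ) × ℝ => borderRoots p.1 p.2.1 p.2.2 := by
  refine measurable_eigenvalues _ (measurable_extend_apply (fun i j => ?_) ?_ ?_)
  · simp only [Matrix.diagonal_apply]
    split_ifs
    · fun_prop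
    · fun_prop
  · fun_prop
  · fun_prop

/-! ### Interlacing and the coordinates of the border -/

/-- The entries of `x` lie strictly between consecutive entries of `y`. -/
def Interlace {n : ℕ} (x : Fin n → ℝ) (y : Fin (n + 1) → ℝ) : Prop :=
  ∀ j : Fin n, y j.castSucc < x j ∧ x j < y j.succ

theorem Interlace.strictMono_right {n : ℕ} {x : Fin n → ℝ} {y : Fin (n + 1) → ℝ}
    (h : Interlace x y) : StrictMono y :=
  Fin.strictMono_iff_lt_succ.2 fun j => (h j).1.trans (h j).2

theorem Interlace.strictMono_left {n : ℕ} {x : Fin n → ℝ} {y : Fin (n + 1) → ℝ}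
    (h : Interlace x y) : StrictMono x := by
  intro i j hij
  exact (h i).2.trans_le ((h.strictMono_right.monotone
    (show i.succ ≤ j.castSucc from hij)).trans (h j).1.le)

/-- The squared border entries and the corner entry of the bordered diagonal matrix with upper left
block `diagonal x` and eigenvalues `y`. -/
noncomputable def borderCoords {n : ℕ} (x : Fin n → ℝ) (y : Fin (n + 1) → ℝ) : Fin (n + 1) → ℝ :=
  Fin.snoc (α := fun _ => ℝ)
    (fun j => -((∏ k, (x j - y k)) / ∏ k ∈ Finset.univ.erase j, (x j - x k)))
    (∑ k, y k - ∑ j, x j)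

theorem prod_erase_sub_ne_zero {ι : Type*} [Fintype ι] [DecidableEq ι] {x : ι → ℝ}
    (hx : Function.Injective x) (j : ι) : ∏ k ∈ Finset.univ.erase j, (x j - x k) ≠ 0 :=
  Finset.prod_ne_zero_iff.2 fun _ hk => sub_ne_zero.2 fun h => Finset.ne_of_mem_erase hk (hx h).symm

/-- Both sides are monic of degree `n + 1`. The corner entry is chosen to match the coefficients of
`X ^ n`, so after removing the leading product both remainders have degree below `n`, and the border
entries are chosen to match their values at the `n` points `x j`. -/
theorem prod_X_sub_C_eq_borderPoly {n : ℕ} {x : Fin n → ℝ} (hx : Function.Injective x)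
    (y : Fin (n + 1) → ℝ) : ∏ k, (X - C (y k)) = borderPoly x
      (fun j => borderCoords x y j.castSucc) (borderCoords x y (Fin.last n)) := by
  set c := borderCoords x y (Fin.last n) with hc
  have hc' : c = ∑ k, y k - ∑ j, x j := by rw [hc, borderCoords, Fin.snoc_last]
  set p : ℝ[X] := ∏ k, (X - C (y k)) with hp
  -- Appending `c` to `x` makes `q` a product of `n + 1` linear factors, to which the Vieta formula
  -- applies as it does to `p`.
  set q : ℝ[X] := ∏ k, (X - C ((Fin.snoc x c : Fin (n + 1) → ℝ) k)) with hq
  have hq' : q = (X - C c) * ∏ j, (X - C (x j)) := by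
    rw [hq, Fin.prod_univ_castSucc, mul_comm]
    simp
  have hpm : p.Monic := monic_prod_X_sub_C _ _
  have hqm : q.Monic := monic_prod_X_sub_C _ _
  have hpd : p.natDegree = n + 1 := by simp [hp]
  have hqd : q.natDegree = n + 1 := by simp [hq]
  have hcoef : p.coeff n = q.coeff n := by
    have h1 := prod_X_sub_C_coeff_card_pred Finset.univ y (by simp)
    have h2 := prod_X_sub_C_coeff_card_pred Finset.univ (Fin.snoc x c : Fin (n + 1) → ℝ) (by simp)
    simp only [Finset.card_univ, Fintype.card_fin, Nat.add_sub_cancel] at h1 h2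
    rw [hp, hq, h1, h2, Fin.sum_univ_castSucc (f := (Fin.snoc x c : Fin (n + 1) → ℝ))]
    simp [hc']
  have hdeg : (p - q).degree < n := by
    rw [degree_lt_iff_coeff_zero]
    intro m hm
    rw [coeff_sub]
    rcases Nat.lt_trichotomy m (n + 1) with h | h | h
    · obtain rfl : m = n := by omega
      rw [hcoef, sub_self]
    · have h1 := hpm.coeff_natDegree
      have h2 := hqm.coeff_natDegree
      rw [hpd] at h1; rw [hqd] at h2
      rw [h, h1, h2, sub_self]
    · rw [coeff_eq_zero_of_natDegree_lt (by omega), coeff_eq_zero_of_natDegree_lt (by omega),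
        sub_self]
  have hdeg2 : (-∑ j, C (borderCoords x y j.castSucc) *
      ∏ k ∈ Finset.univ.erase j, (X - C (x k))).degree < n := by
    rw [← mem_degreeLT]
    refine Submodule.neg_mem _ (Submodule.sum_mem _ fun j _ => ?_)
    rw [← smul_eq_C_mul]
    refine Submodule.smul_mem _ _ ?_
    rw [mem_degreeLT, degree_prod]
    simp only [degree_X_sub_C, Finset.sum_const, Finset.mem_univ, Finset.card_erase_of_mem,
      Finset.card_univ, Fintype.card_fin, nsmul_eq_mul, mul_one]
    exact_mod_cast Nat.sub_lt (Fin.pos j) one_pos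
  have heq : p - q = -∑ j, C (borderCoords x y j.castSucc) *
      ∏ k ∈ Finset.univ.erase j, (X - C (x k)) := by
    apply Polynomial.eq_of_degrees_lt_of_eval_index_eq (s := Finset.univ) (v := x) hx.injOn
    · simpa using hdeg
    · simpa using hdeg2
    · intro i _
      have := eval_borderPoly_self x (fun j => borderCoords x y j.castSucc) c i
      rw [borderPoly, ← hq', sub_eq_add_neg, eval_add] at this
      have hqi : q.eval (x i) = 0 := by
        rw [hq', eval_mul, eval_prod, Finset.prod_eq_zero (Finset.mem_univ i) (by simp), mul_zero]
      rw [eval_sub, hqi, sub_zero]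
      rw [hqi, zero_add] at this
      rw [this, borderCoords, Fin.snoc_castSucc, neg_mul, neg_neg,
        div_mul_cancel₀ _ (prod_erase_sub_ne_zero hx i), hp, eval_prod]
      simp
  rw [borderPoly, ← hq', sub_eq_add_neg, ← heq]
  ring

theorem borderCoords_of_prod_eq {n : ℕ} {x : Fin n → ℝ} (hx : Function.Injective x)
    {y z : Fin (n + 1) → ℝ}
    (h : ∏ k, (X - C (y k)) = borderPoly x (fun j => z j.castSucc) (z (Fin.last n)))
    (hs : ∑ k, y k = ∑ j, x j + z (Fin.last n)) : borderCoords x y = z := by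
  ext k
  refine Fin.lastCases ?_ (fun j => ?_) k
  · rw [borderCoords, Fin.snoc_last, hs]; ring
  · have h1 := congrArg (eval (x j)) h
    rw [eval_borderPoly_self, eval_prod] at h1
    simp only [eval_sub, eval_X, eval_C] at h1
    rw [borderCoords, Fin.snoc_castSucc, h1]
    have := prod_erase_sub_ne_zero hx j
    field_simp

/-- After division by `∏ (t - x j)` the polynomial is `t - c - ∑ r j / (t - x j)`. Subtracting its
vanishing at a root `a` gives `(t - a) (1 + ∑ r j / ((a - x j) (t - x j)))`. At another root the
second factor vanishes, so some product in it is negative. Since `X - a` is divided out as a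
polynomial, the argument covers a repeated root as well and excludes it. -/
theorem exists_between_roots {ι κ : Type*} [Fintype ι] [DecidableEq ι] [Fintype κ] [DecidableEq κ]
    {x r : ι → ℝ} (hx : Function.Injective x) (hr : ∀ j, 0 < r j) {c : ℝ} {y : κ → ℝ}
    (h : ∏ k, (X - C (y k)) = borderPoly x r c) {i i' : κ} (hi : i ≠ i') :
    ∃ j, (y i - x j) * (y i' - x j) < 0 := by
  have hne : ∀ k j, y k - x j ≠ 0 := by
    intro k j hkj
    have h1 := congrArg (eval (x j)) h
    rw [eval_borderPoly_self, eval_prod, Finset.prod_eq_zero (Finset.mem_univ k)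
      (by simp; linarith)] at h1
    have := mul_ne_zero (hr j).ne' (prod_erase_sub_ne_zero hx j)
    exact this (by linarith)
  set a := y i with ha
  -- The quotient of the polynomial by `X - C a`, written out so that its value at the other root
  -- can be compared with zero.
  set B : ℝ[X] := ∏ j, (X - C (x j)) +
    ∑ j, C (r j / (a - x j)) * ∏ k ∈ Finset.univ.erase j, (X - C (x k)) with hB
  have hW : ∀ t : ℝ, (∀ j, t - x j ≠ 0) → ∀ j, ∏ k ∈ Finset.univ.erase j, (t - x k) =
      (∏ k, (t - x k)) / (t - x j) := by
    intro t ht j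
    rw [← Finset.mul_prod_erase _ _ (Finset.mem_univ j), mul_div_cancel_left₀ _ (ht j)]
  have ha0 : a - c = ∑ j, r j / (a - x j) := by
    have h1 := congrArg (eval a) h
    rw [eval_borderPoly, eval_prod, Finset.prod_eq_zero (Finset.mem_univ i) (by simp [ha])] at h1
    have hP : ∏ k, (a - x k) ≠ 0 := Finset.prod_ne_zero_iff.2 fun j _ => hne i j
    have h2 : ∑ j, r j * ∏ k ∈ Finset.univ.erase j, (a - x k) =
        (∑ j, r j / (a - x j)) * ∏ k, (a - x k) := by
      rw [Finset.sum_mul]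
      refine Finset.sum_congr rfl fun j _ => ?_
      rw [hW a (hne i)]; ring
    rw [h2, ← sub_mul] at h1
    have := (mul_eq_zero.1 h1.symm).resolve_right hP
    linarith
  have hfac : borderPoly x r c = (X - C a) * B := by
    have h3 : (X - C c : ℝ[X]) = (X - C a) + ∑ j, C (r j / (a - x j)) := by
      rw [← map_sum, ← ha0, C_sub]; ring
    rw [borderPoly, hB, h3, add_mul, mul_add, add_sub_assoc, Finset.sum_mul, Finset.mul_sum,
      ← Finset.sum_sub_distrib]
    congr 1
    refine Finset.sum_congr rfl fun j _ => ?_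
    rw [← Finset.mul_prod_erase _ _ (Finset.mem_univ j)]
    have : C (r j) = C (r j / (a - x j)) * (C a - C (x j)) := by
      rw [← C_sub, ← C_mul, div_mul_cancel₀ _ (hne i j)]
    rw [this]
    ring
  have hB2 : B = ∏ k ∈ Finset.univ.erase i, (X - C (y k)) := by
    apply mul_left_cancel₀ (X_sub_C_ne_zero a)
    rw [← hfac, ← h, ← Finset.mul_prod_erase _ _ (Finset.mem_univ i)]
  have hB3 : B.eval (y i') = 0 := by
    rw [hB2, eval_prod, Finset.prod_eq_zero (i := i') (by simp [hi.symm]) (by simp)]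
  by_contra! hcon
  have hpos : ∀ j, 0 < (a - x j) * (y i' - x j) := fun j =>
    lt_of_le_of_ne (hcon j) (mul_ne_zero (hne i j) (hne i' j)).symm
  have hB4 : B.eval (y i') = (∏ k, (y i' - x k)) *
      (1 + ∑ j, r j / ((a - x j) * (y i' - x j))) := by
    rw [hB, eval_add, eval_prod, eval_finsetSum, mul_add, mul_one, Finset.mul_sum]
    simp only [eval_sub, eval_X, eval_C, eval_mul, eval_prod]
    congr 1
    refine Finset.sum_congr rfl fun j _ => ?_
    rw [hW _ (hne i')]
    have := hne i j
    have := hne i' j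
    field_simp
  rw [hB3] at hB4
  have h5 : 0 < 1 + ∑ j, r j / ((a - x j) * (y i' - x j)) :=
    add_pos_of_pos_of_nonneg one_pos
      (Finset.sum_nonneg fun j _ => (div_pos (hr j) (hpos j)).le)
  exact (mul_ne_zero (Finset.prod_ne_zero_iff.2 fun j _ => hne i' j) h5.ne') hB4.symm

/-- Each gap between consecutive roots contains some `x (f i)`. The map `f` from `Fin n` to itself
is strictly increasing, hence the identity. -/
theorem interlace_of_prod_eq {n : ℕ} {x r : Fin n → ℝ} (hx : StrictMono x) (hr : ∀ j, 0 < r j)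
    {c : ℝ} {y : Fin (n + 1) → ℝ} (hy : Monotone y)
    (h : ∏ k, (X - C (y k)) = borderPoly x r c) : Interlace x y := by
  have h1 : ∀ i : Fin n, ∃ j, y i.castSucc < x j ∧ x j < y i.succ := by
    intro i
    obtain ⟨j, hj⟩ := exists_between_roots hx.injective hr h (Fin.castSucc_lt_succ (i := i)).ne
    refine ⟨j, ?_⟩
    have := hy (Fin.castSucc_lt_succ (i := i)).le
    constructor <;> nlinarith
  choose f hf using h1
  have hfm : StrictMono f := by
    intro i i' hii
    apply hx.lt_iff_lt.1
    exact (hf i).2.trans_le ((hy (show i.succ ≤ i'.castSucc from hii)).trans (hf i').1.le)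
  have : ∀ i, f i = i := by
    intro i
    exact le_antisymm hfm.apply_le hfm.le_apply
  intro j
  simpa [this] using hf j

/-- For `k ≠ j` each factor `x j - x k` below is paired with a factor above of the same sign. The
two unpaired factors belong to the neighbours of `x j` in `y` and have opposite signs, which cancels
the minus sign. -/
theorem Interlace.borderCoords_pos {n : ℕ} {x : Fin n → ℝ} {y : Fin (n + 1) → ℝ}
    (h : Interlace x y) (j : Fin n) : 0 < borderCoords x y j.castSucc := by
  rw [borderCoords, Fin.snoc_castSucc, Fin.prod_univ_succAbove _ j.castSucc,
    ← Finset.mul_prod_erase _ _ (Finset.mem_univ j), Fin.succAbove_castSucc_self, ← mul_assoc,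
    mul_div_assoc, ← Finset.prod_div_distrib, ← neg_mul]
  refine mul_pos ?_ (Finset.prod_pos fun k hk => ?_)
  · have := h j
    nlinarith
  · have hx := h.strictMono_left
    rcases lt_or_gt_of_ne (Finset.ne_of_mem_erase hk) with hlt | hlt
    · rw [Fin.succAbove_castSucc_of_lt _ _ hlt]
      exact div_pos (by linarith [(h k).1, hx hlt]) (by linarith [hx hlt])
    · rw [Fin.succAbove_castSucc_of_le _ _ hlt.le]
      exact div_pos_of_neg_of_neg (by linarith [(h k).2, hx hlt]) (by linarith [hx hlt])

theorem injOn_borderCoords {n : ℕ} {x : Fin n → ℝ} (hx : Function.Injective x) :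
    Set.InjOn (borderCoords x) {y | Interlace x y} := by
  intro y hy y' hy' heq
  have h : ∏ k, (X - C (y k)) = ∏ k, (X - C (y' k)) := by
    rw [prod_X_sub_C_eq_borderPoly hx, heq, ← prod_X_sub_C_eq_borderPoly hx]
  obtain ⟨σ, hσ⟩ := exists_perm_of_prod_X_sub_C_eq h
  have := Tuple.unique_monotone (f := y) (σ := 1) (τ := σ) hy.strictMono_right.monotone
    (by rw [hσ]; exact hy'.strictMono_right.monotone)
  rw [hσ] at this
  exact this

theorem image_borderCoords {n : ℕ} {x : Fin n → ℝ} (hx : StrictMono x) :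
    borderCoords x '' {y | Interlace x y} = {z | ∀ j : Fin n, 0 < z j.castSucc} := by
  ext z
  constructor
  · rintro ⟨y, hy, rfl⟩ j
    exact hy.borderCoords_pos j
  · intro hz
    have hz' : ∀ j : Fin n, 0 < z j.castSucc := hz
    set w := borderRoots x (fun j => z j.castSucc) (z (Fin.last n)) with hw
    have hwp := prod_borderRoots x (fun j => (hz' j).le) (z (Fin.last n))
    have hsp : ∏ k, (X - C ((w ∘ Tuple.sort w) k)) = borderPoly x (fun j => z j.castSucc)
        (z (Fin.last n)) := by
      rw [← hwp]
      exact Equiv.prod_comp (Tuple.sort w) fun k => X - C (w k)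
    refine ⟨w ∘ Tuple.sort w, interlace_of_prod_eq hx hz' (Tuple.monotone_sort w) hsp, ?_⟩
    apply borderCoords_of_prod_eq hx.injective hsp
    rw [← sum_borderRoots]
    exact Equiv.sum_comp (Tuple.sort w) w

theorem sum_sq_eq_of_interlace {n : ℕ} {x : Fin n → ℝ} {y : Fin (n + 1) → ℝ} (h : Interlace x y) :
    ∑ k, y k ^ 2 = ∑ j, x j ^ 2 + 2 * ∑ j : Fin n, borderCoords x y j.castSucc +
      borderCoords x y (Fin.last n) ^ 2 := by
  have hr : ∀ j : Fin n, 0 ≤ borderCoords x y j.castSucc := fun j => (h.borderCoords_pos j).le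
  rw [← sum_borderRoots_sq x hr]
  have hs : IsSymmFun fun y : Fin (n + 1) → ℝ => ∑ k, y k ^ 2 := fun σ y =>
    Equiv.sum_comp σ fun k => y k ^ 2
  apply hs.eq_of_prod_eq
  rw [prod_borderRoots _ hr, prod_X_sub_C_eq_borderPoly h.strictMono_left.injective]

theorem det_vandermonde_pos {n : ℕ} {x : Fin n → ℝ} (hx : StrictMono x) :
    0 < (Matrix.vandermonde x).det := by
  rw [Matrix.det_vandermonde]
  exact Finset.prod_pos fun i _ => Finset.prod_pos fun j hj =>
    sub_pos.2 (hx (Finset.mem_Ioi.1 hj))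

theorem abs_prod_prod_erase_sub {n : ℕ} (y : Fin n → ℝ) :
    |∏ k, ∏ l ∈ Finset.univ.erase k, (y k - y l)| = (Matrix.vandermonde y).det ^ 2 := by
  have h := Finset.prod_prod_Ioi_mul_eq_prod_prod_off_diag fun i j : Fin n => y j - y i
  have h2 : ∀ k : Fin n, ({k}ᶜ : Finset (Fin n)) = Finset.univ.erase k := fun k => by ext; simp
  simp only [h2] at h
  rw [← h, Finset.abs_prod, Matrix.det_vandermonde, ← Finset.prod_pow]
  refine Finset.prod_congr rfl fun i _ => ?_
  rw [Finset.abs_prod, ← Finset.prod_pow]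
  refine Finset.prod_congr rfl fun j _ => ?_
  rw [abs_mul, abs_sub_comm, ← sq, sq_abs]

/-! ### The Jacobian and the change of variables -/

/-- The Jacobian matrix of `borderCoords x`. -/
noncomputable def borderJacobian {n : ℕ} (x : Fin n → ℝ) (y : Fin (n + 1) → ℝ) :
    Matrix (Fin (n + 1)) (Fin (n + 1)) ℝ :=
  Matrix.of (Fin.snoc (α := fun _ => Fin (n + 1) → ℝ)
    (fun j k => (∏ l ∈ Finset.univ.erase k, (x j - y l)) / ∏ k ∈ Finset.univ.erase j, (x j - x k))
    (fun _ => 1))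

theorem hasFDerivAt_borderCoords {n : ℕ} (x : Fin n → ℝ) (y : Fin (n + 1) → ℝ) :
    HasFDerivAt (borderCoords x) (Matrix.toLin' (borderJacobian x y)).toContinuousLinearMap y := by
  rw [hasFDerivAt_pi']
  intro k
  refine Fin.lastCases ?_ (fun j => ?_) k
  · simp only [borderCoords, Fin.snoc_last]
    have h : HasFDerivAt (fun y : Fin (n + 1) → ℝ => ∑ k, y k - ∑ j, x j)
      (∑ k, ContinuousLinearMap.proj (R := ℝ) (φ := fun _ : Fin (n + 1) => ℝ) k) y :=
      (HasFDerivAt.fun_sum fun k _ => hasFDerivAt_apply k y).sub_const _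
    refine h.congr_fderiv ?_
    ext v
    simp [borderJacobian, Matrix.mulVec, dotProduct]
  · simp only [borderCoords, Fin.snoc_castSucc, div_eq_mul_inv]
    have h := ((HasFDerivAt.finsetProd (u := Finset.univ) (x := y)
      (g := fun (k : Fin (n + 1)) (y : Fin (n + 1) → ℝ) => x j - y k)
      (g' := fun k => -ContinuousLinearMap.proj (R := ℝ) (φ := fun _ : Fin (n + 1) => ℝ) k)
      (fun k _ => (hasFDerivAt_apply k y).const_sub (x j))).mul_const
        (∏ k ∈ Finset.univ.erase j, (x j - x k))⁻¹).neg
    refine h.congr_fderiv ?_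
    ext v
    simp only [neg_apply, smul_apply,
      sum_apply, ContinuousLinearMap.proj_apply, smul_eq_mul, Finset.mul_sum,
      ← Finset.sum_neg_distrib, ContinuousLinearMap.comp_apply, LinearMap.coe_toContinuousLinearMap',
      Matrix.toLin'_apply, Matrix.mulVec, dotProduct, borderJacobian, Matrix.of_apply,
      Fin.snoc_castSucc]
    exact Finset.sum_congr rfl fun k _ => by ring

/-- Up to column scaling, the product with the Vandermonde matrix of `y` is Lagrange interpolation
of the monomials at the nodes `y`: a row `j` evaluates at `x j`, the last row extracts the
coefficient of degree `n`. The result is a scaled Vandermonde matrix of `x` bordered by a unit row.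
The scaling factors multiply to `±Δ²`, so one power of each Vandermonde determinant survives. -/
theorem det_borderJacobian {n : ℕ} {x : Fin n → ℝ} {y : Fin (n + 1) → ℝ}
    (hx : Function.Injective x) (hy : Function.Injective y) :
    |(borderJacobian x y).det| =
      |(Matrix.vandermonde y).det| / |(Matrix.vandermonde x).det| := by
  set D : Fin n → ℝ := fun j => ∏ k ∈ Finset.univ.erase j, (x j - x k) with hD
  set E : Fin (n + 1) → ℝ := fun k => ∏ l ∈ Finset.univ.erase k, (y k - y l) with hE
  have hE0 : ∀ k, E k ≠ 0 := prod_erase_sub_ne_zero hy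
  have hD0 : ∀ k, D k ≠ 0 := prod_erase_sub_ne_zero hx
  set P : Matrix (Fin (n + 1)) (Fin (n + 1)) ℝ :=
    Matrix.of (Fin.snoc (α := fun _ => Fin (n + 1) → ℝ) (fun j i => (D j)⁻¹ * x j ^ (i : ℕ))
      (fun i => if i = Fin.last n then 1 else 0)) with hP
  have hmul : borderJacobian x y * (Matrix.diagonal (fun k => (E k)⁻¹) * Matrix.vandermonde y) =
      P := by
    ext j i
    rw [Matrix.mul_apply]
    simp only [Matrix.diagonal_mul, Matrix.vandermonde_apply]
    have hdeg : (Polynomial.X ^ (i : ℕ) : Polynomial ℝ).degree <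
        (Finset.univ : Finset (Fin (n + 1))).card := by
      rw [Polynomial.degree_X_pow]
      exact_mod_cast i.2.trans_le (by simp)
    refine Fin.lastCases ?_ (fun j => ?_) j
    · simp only [borderJacobian, hP, Matrix.of_apply, Fin.snoc_last, one_mul]
      have := Lagrange.coeff_eq_sum (s := Finset.univ) (v := y) hy.injOn hdeg
      simp only [Finset.card_univ, Fintype.card_fin, Nat.add_sub_cancel, Polynomial.coeff_X_pow,
        Polynomial.eval_pow, Polynomial.eval_X] at this
      rw [Finset.sum_congr rfl fun k _ => mul_comm _ _]
      simp only [← div_eq_mul_inv]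
      rw [← this]
      simp only [Fin.ext_iff, Fin.val_last, eq_comm]
    · simp only [borderJacobian, hP, Matrix.of_apply, Fin.snoc_castSucc]
      have := congrArg (Polynomial.eval (x j))
        (Lagrange.eq_interpolate (s := Finset.univ) (v := y) hy.injOn hdeg)
      rw [Lagrange.interpolate_apply, Polynomial.eval_finsetSum] at this
      simp only [Polynomial.eval_pow, Polynomial.eval_X, Polynomial.eval_mul, Polynomial.eval_C,
        Lagrange.basis, Polynomial.eval_prod, Lagrange.basisDivisor, Polynomial.eval_sub,
        Finset.prod_mul_distrib, Finset.prod_inv_distrib] at this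
      rw [this, Finset.mul_sum]
      refine Finset.sum_congr rfl fun k _ => ?_
      simp only [hE, hD]
      ring
  have hPdet : |P.det| = |(Matrix.vandermonde x).det|⁻¹ := by
    have h1 : P.det = (∏ j, (D j)⁻¹) * (Matrix.vandermonde x).det := by
      -- The last row of `P` is a unit vector, so expansion along it leaves the Vandermonde matrix
      -- of `x` with rows scaled by `(D j)⁻¹`.
      rw [Matrix.det_succ_row P (Fin.last n), Fin.sum_univ_castSucc, Finset.sum_eq_zero]
      · rw [← Matrix.det_diagonal, ← Matrix.det_mul, zero_add]
        have : (P (Fin.last n) (Fin.last n)) = 1 := by simp [hP]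
        rw [this, ← two_mul, pow_mul]
        simp only [even_two, Even.neg_pow, one_pow, mul_one, one_mul]
        congr 1
        ext i j
        simp [hP, Matrix.diagonal_mul, Matrix.vandermonde_apply]
      · intro i _
        simp [hP, (Fin.castSucc_lt_last i).ne]
    have h2 := abs_prod_prod_erase_sub x
    rw [h1, abs_mul, Finset.prod_inv_distrib, abs_inv, h2, ← sq_abs]
    have : |(Matrix.vandermonde x).det| ≠ 0 :=
      abs_ne_zero.2 (Matrix.det_vandermonde_ne_zero_iff.2 hx)
    field_simp
  have h3 := congrArg (fun M => |Matrix.det M|) hmul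
  simp only [Matrix.det_mul, Matrix.det_diagonal, abs_mul, hPdet,
    Finset.prod_inv_distrib, abs_inv] at h3
  rw [abs_prod_prod_erase_sub y, ← sq_abs] at h3
  have : |(Matrix.vandermonde y).det| ≠ 0 := abs_ne_zero.2 (Matrix.det_vandermonde_ne_zero_iff.2 hy)
  rw [div_eq_mul_inv, ← h3]
  field_simp

theorem measurableSet_interlace {n : ℕ} (x : Fin n → ℝ) :
    MeasurableSet {y : Fin (n + 1) → ℝ | Interlace x y} := by
  simp only [Interlace, Set.ofPred_forall]
  refine MeasurableSet.iInter fun j => MeasurableSet.inter ?_ ?_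
  · exact measurableSet_lt (measurable_pi_apply _) measurable_const
  · exact measurableSet_lt measurable_const (measurable_pi_apply _)

theorem setLIntegral_borderRoots {n : ℕ} {x : Fin n → ℝ} (hx : StrictMono x)
    {φ : (Fin (n + 1) → ℝ) → ENNReal} (hφ : IsSymmFun φ) :
    ∫⁻ z in {z : Fin (n + 1) → ℝ | ∀ j : Fin n, 0 < z j.castSucc},
      φ (borderRoots x (fun j => z j.castSucc) (z (Fin.last n))) *
        ENNReal.ofReal (Real.exp (-(∑ j : Fin n, z j.castSucc) - z (Fin.last n) ^ 2 / 2)) =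
    ∫⁻ y in {y | Interlace x y}, φ y * ENNReal.ofReal
      ((Matrix.vandermonde y).det / (Matrix.vandermonde x).det *
        Real.exp (-(∑ k, y k ^ 2) / 2 + (∑ j, x j ^ 2) / 2)) := by
  rw [← image_borderCoords hx, lintegral_image_eq_lintegral_abs_det_fderiv_mul volume
    (measurableSet_interlace x) (fun y _ => (hasFDerivAt_borderCoords x y).hasFDerivWithinAt)
    (injOn_borderCoords hx.injective)]
  refine setLIntegral_congr_fun (measurableSet_interlace x) fun y hy => ?_
  have hy' : Interlace x y := hy
  have hφ' : φ (borderRoots x (fun j => borderCoords x y j.castSucc)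
      (borderCoords x y (Fin.last n))) = φ y := by
    apply hφ.eq_of_prod_eq
    rw [prod_borderRoots _ (fun j => (hy'.borderCoords_pos j).le),
      prod_X_sub_C_eq_borderPoly hx.injective]
  simp only [hφ']
  rw [mul_left_comm, ← ENNReal.ofReal_mul (abs_nonneg _)]
  congr 2
  rw [LinearMap.det_toContinuousLinearMap, LinearMap.det_toLin',
    det_borderJacobian hx.injective hy'.strictMono_right.injective,
    abs_of_pos (det_vandermonde_pos hx), abs_of_pos (det_vandermonde_pos hy'.strictMono_right),
    sum_sq_eq_of_interlace hy']
  ring_nf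

end PolyEns

/-! ### Complex Gaussian vectors and unitary invariance -/

namespace PolyEns
open Complex (I)

/-- The complex vector with real parts `z (inl j)` and imaginary parts `z (inr j)`. -/
noncomputable def toComplexVec {ι : Type*} (z : ι ⊕ ι → ℝ) : ι → ℂ :=
  fun j => ⟨z (.inl j), z (.inr j)⟩

/-- The real vector of the real and imaginary parts of the entries of `w`. -/
def ofComplexVec {ι : Type*} (w : ι → ℂ) : ι ⊕ ι → ℝ :=
  Sum.elim (fun j => (w j).re) (fun j => (w j).im)

theorem measurable_toComplexVec {ι : Type*} : Measurable (toComplexVec (ι := ι)) := by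
  refine measurable_pi_lambda _ fun j => ?_
  have : (fun z : ι ⊕ ι → ℝ => toComplexVec z j) =
      fun z => Complex.equivRealProdCLM.symm (z (.inl j), z (.inr j)) := rfl
  rw [this]
  exact Complex.equivRealProdCLM.symm.continuous.measurable.comp (by fun_prop)

theorem sum_sq_ofComplexVec {ι : Type*} [Fintype ι] (w : ι → ℂ) :
    ∑ k, ofComplexVec w k ^ 2 = ∑ j, ‖w j‖ ^ 2 := by
  rw [Fintype.sum_sum_type, ← Finset.sum_add_distrib]
  refine Finset.sum_congr rfl fun j _ => ?_
  rw [Complex.sq_norm, Complex.normSq_apply]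
  simp [ofComplexVec, sq]

theorem sum_norm_sq_mulVec {ι : Type*} [Fintype ι] [DecidableEq ι] {U : Matrix ι ι ℂ}
    (hU : star U * U = 1) (w : ι → ℂ) : ∑ j, ‖U.mulVec w j‖ ^ 2 = ∑ j, ‖w j‖ ^ 2 := by
  have h : ∀ w : ι → ℂ, ((∑ j, ‖w j‖ ^ 2 : ℝ) : ℂ) = dotProduct (star w) w := fun w => by
    simp [dotProduct, Complex.conj_mul']
  apply Complex.ofReal_injective
  rw [h, h, Matrix.star_mulVec, Matrix.dotProduct_mulVec, Matrix.vecMul_vecMul,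
    ← Matrix.star_eq_conjTranspose, hU, Matrix.vecMul_one]

/-- The action of a unitary matrix on pairs of real and imaginary parts. -/
noncomputable def realUnitary {ι : Type*} [Fintype ι] [DecidableEq ι] (U : Matrix ι ι ℂ)
    (hU : star U * U = 1) : EuclideanSpace ℝ (ι ⊕ ι) →ₗᵢ[ℝ] EuclideanSpace ℝ (ι ⊕ ι) where
  toFun z := WithLp.toLp 2 (ofComplexVec (U.mulVec (toComplexVec z.ofLp)))
  map_add' x y := by
    have : toComplexVec (x + y).ofLp = toComplexVec x.ofLp + toComplexVec y.ofLp := by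
      ext j; simp [toComplexVec, Complex.ext_iff]
    rw [this, Matrix.mulVec_add]
    ext (k | k) <;> simp [ofComplexVec]
  map_smul' a x := by
    have : toComplexVec (a • x).ofLp = (a : ℂ) • toComplexVec x.ofLp := by
      ext j; simp [toComplexVec, Complex.ext_iff]
    rw [this, Matrix.mulVec_smul]
    ext (k | k) <;> simp [ofComplexVec]
  norm_map' x := by
    have h : ofComplexVec (toComplexVec x.ofLp) = x.ofLp := by
      ext (k | k) <;> rfl
    simp only [LinearMap.coe_mk, AddHom.coe_mk]
    rw [EuclideanSpace.norm_eq, EuclideanSpace.norm_eq]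
    congr 1
    simp only [Real.norm_eq_abs, sq_abs]
    rw [sum_sq_ofComplexVec, sum_norm_sq_mulVec hU, ← sum_sq_ofComplexVec, h]

/-- The law of a vector of independent standard complex Gaussian variables. -/
noncomputable def complexGaussian (ι : Type*) [Fintype ι] : Measure (ι → ℂ) :=
  (Measure.pi fun _ : ι ⊕ ι => gaussianReal 0 (1 / 2)).map toComplexVec

instance (ι : Type*) [Fintype ι] : IsProbabilityMeasure (complexGaussian ι) :=
  Measure.isProbabilityMeasure_map measurable_toComplexVec.aemeasurable

theorem pi_gaussianReal_half (ι : Type*) [Fintype ι] :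
    (Measure.pi fun _ : ι => gaussianReal 0 (1 / 2)) =
      (stdGaussian (EuclideanSpace ℝ ι)).map (fun z k => √(1 / 2) * z.ofLp k) := by
  have h1 : gaussianReal 0 (1 / 2) = (gaussianReal 0 1).map (fun t => √(1 / 2) * t) := by
    rw [gaussianReal_map_const_mul, mul_zero, mul_one]
    congr 1
    ext
    simp
  have : ∀ i : ι, SigmaFinite ((gaussianReal 0 1).map (fun t => √(1 / 2) * t)) := fun i => by
    rw [← h1]; infer_instance
  rw [← map_pi_eq_stdGaussian, Measure.map_map (by fun_prop) (by fun_prop), h1,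
    ← Measure.pi_map_pi (fun _ => by fun_prop)]
  rfl

/-- A unitary matrix acts on real and imaginary parts as a linear isometry, which preserves the
standard real Gaussian law; the scaling by `√(1 / 2)` commutes with it. -/
theorem complexGaussian_map_mulVec {ι : Type*} [Fintype ι] [DecidableEq ι] {U : Matrix ι ι ℂ}
    (hU : star U * U = 1) : (complexGaussian ι).map U.mulVec = complexGaussian ι := by
  have hUm : Measurable U.mulVec := by
    refine measurable_pi_lambda _ fun i => ?_
    simp only [Matrix.mulVec, dotProduct]
    fun_prop
  have hs : Measurable fun (z : EuclideanSpace ℝ (ι ⊕ ι)) k => √(1 / 2) * z.ofLp k := by fun_prop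
  rw [complexGaussian, pi_gaussianReal_half, Measure.map_map measurable_toComplexVec hs]
  conv_rhs => rw [← stdGaussian_map ((realUnitary U hU).toLinearIsometryEquiv rfl)]
  rw [Measure.map_map hUm (measurable_toComplexVec.comp hs), Measure.map_map
    (measurable_toComplexVec.comp hs) (by fun_prop)]
  congr 1
  ext z : 1
  have h : ∀ (a : ℝ) (w : ι ⊕ ι → ℝ), toComplexVec (fun k => a * w k) =
      (a : ℂ) • toComplexVec w := fun a w => by
    ext j
    apply Complex.ext <;> simp [toComplexVec]
  simp only [Function.comp_apply, LinearIsometry.coe_toLinearIsometryEquiv, h, Matrix.mulVec_smul]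
  rfl

theorem map_prodMk_eq_complexGaussian {Ω : Type*} [MeasurableSpace Ω] {μ : Measure Ω}
    [IsProbabilityMeasure μ] {n : ℕ} {v : Ω → Fin n → ℂ} {c : Ω → ℝ}
    (hc : HasLaw c (gaussianReal 0 1) μ)
    (hre : ∀ j, HasLaw (fun ω => (v ω j).re) (gaussianReal 0 (1 / 2)) μ)
    (him : ∀ j, HasLaw (fun ω => (v ω j).im) (gaussianReal 0 (1 / 2)) μ)
    (hindep : iIndepFun (Sum.elim (fun _ : Unit => c)
      (Sum.elim (fun (j : Fin n) ω => (v ω j).re) (fun (j : Fin n) ω => (v ω j).im))) μ) :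
    AEMeasurable (fun ω => (v ω, c ω)) μ ∧
    μ.map (fun ω => (v ω, c ω)) = (complexGaussian (Fin n)).prod (gaussianReal 0 1) := by
  set F := (Sum.elim (fun _ : Unit => c)
      (Sum.elim (fun (j : Fin n) ω => (v ω j).re) (fun (j : Fin n) ω => (v ω j).im))) with hF
  let κ : Unit ⊕ (Fin n ⊕ Fin n) → Measure ℝ :=
    Sum.elim (fun _ => gaussianReal 0 1) (fun _ => gaussianReal 0 (1 / 2))
  have hFm : ∀ k, AEMeasurable (F k) μ := by
    rintro (k | k | k)
    · exact hc.aemeasurable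
    · exact (hre k).aemeasurable
    · exact (him k).aemeasurable
  have hlaw : μ.map (fun ω k => F k ω) = Measure.pi κ := by
    rw [hindep.map_fun_eq_pi_map hFm]
    congr 1
    ext1 k
    rcases k with k | k | k
    · exact hc.map_eq
    · exact (hre k).map_eq
    · exact (him k).map_eq
  have hκ : ∀ k, SigmaFinite (κ k) := by
    rintro (k | k) <;> simp only [κ, Sum.elim_inl, Sum.elim_inr] <;> infer_instance
  let g : (Unit ⊕ (Fin n ⊕ Fin n) → ℝ) → (Fin n → ℂ) × ℝ :=
    fun z => (toComplexVec (fun k => z (.inr k)), z (.inl ()))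
  have hg : Measurable g := (measurable_toComplexVec.comp (by fun_prop)).prodMk (by fun_prop)
  have hvc : (fun ω => (v ω, c ω)) = g ∘ fun ω k => F k ω := rfl
  have hm : AEMeasurable (fun ω k => F k ω) μ := aemeasurable_pi_lambda _ hFm
  refine ⟨by rw [hvc]; exact hg.comp_aemeasurable hm, ?_⟩
  have h2 : MeasurePreserving (MeasurableEquiv.sumPiEquivProdPi fun _ => ℝ) (Measure.pi κ)
      ((Measure.pi fun _ : Unit => gaussianReal 0 1).prod
        (Measure.pi fun _ : Fin n ⊕ Fin n => gaussianReal 0 (1 / 2))) :=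
    measurePreserving_sumPiEquivProdPi κ
  have h3 : MeasurePreserving (MeasurableEquiv.funUnique Unit ℝ)
      (Measure.pi fun _ : Unit => gaussianReal 0 1) (gaussianReal 0 1) :=
    measurePreserving_funUnique (gaussianReal 0 1) Unit
  have h4 : MeasurePreserving (toComplexVec (ι := Fin n))
      (Measure.pi fun _ : Fin n ⊕ Fin n => gaussianReal 0 (1 / 2)) (complexGaussian (Fin n)) :=
    ⟨measurable_toComplexVec, rfl⟩
  have h5 := (Measure.measurePreserving_swap.comp (h3.prod h4)).comp h2
  rw [hvc, ← AEMeasurable.map_map_of_aemeasurable hg.aemeasurable hm, hlaw]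
  exact h5.map_eq

/-! ### Squared moduli are exponential -/

/-- The exponential law of rate one. -/
noncomputable def expLaw : Measure ℝ :=
  volume.withDensity ((Set.Ioi 0).indicator fun t => ENNReal.ofReal (Real.exp (-t)))

theorem measurable_expLaw_density :
    Measurable ((Set.Ioi (0 : ℝ)).indicator fun t => ENNReal.ofReal (Real.exp (-t))) :=
  Measurable.indicator (by fun_prop) measurableSet_Ioi

theorem lintegral_expLaw {φ : ℝ → ENNReal} (hφ : Measurable φ) :
    ∫⁻ t, φ t ∂expLaw = ∫⁻ t in Set.Ioi 0, ENNReal.ofReal (Real.exp (-t)) * φ t := by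
  rw [expLaw, lintegral_withDensity_eq_lintegral_mul _ measurable_expLaw_density hφ,
    ← lintegral_indicator measurableSet_Ioi]
  refine lintegral_congr fun t => ?_
  simp only [Pi.mul_apply, Set.indicator]
  split_ifs <;> simp

/-- In polar coordinates the density is `π⁻¹ exp (-r²) r dr dθ`; the angle contributes `2π`, and `t
= r²` gives `exp (-t) dt`. -/
theorem lintegral_gaussian_sq_add_sq {φ : ℝ → ENNReal} (hφ : Measurable φ) :
    ∫⁻ p : ℝ × ℝ, φ (p.1 ^ 2 + p.2 ^ 2) ∂((gaussianReal 0 (1 / 2)).prod (gaussianReal 0 (1 / 2))) =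
      ∫⁻ t, φ t ∂expLaw := by
  have h1 : (1 / 2 : NNReal) ≠ 0 := by norm_num
  rw [gaussianReal_of_var_ne_zero _ h1, prod_withDensity (measurable_gaussianPDF _ _)
    (measurable_gaussianPDF _ _), lintegral_withDensity_eq_lintegral_mul _ (by
      exact ((measurable_gaussianPDF _ _).comp measurable_fst).mul
        ((measurable_gaussianPDF _ _).comp measurable_snd)) (by fun_prop), lintegral_expLaw hφ]
  have h2 : ∀ p : ℝ × ℝ, gaussianPDF 0 (1 / 2) p.1 * gaussianPDF 0 (1 / 2) p.2 =
      ENNReal.ofReal (Real.pi⁻¹ * Real.exp (-(p.1 ^ 2 + p.2 ^ 2))) := by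
    intro p
    rw [gaussianPDF, gaussianPDF, ← ENNReal.ofReal_mul (gaussianPDFReal_nonneg _ _ _)]
    congr 1
    simp only [gaussianPDFReal]
    have : (2 * Real.pi * ((1 / 2 : NNReal) : ℝ)) = Real.pi := by simp; ring
    have h3 : (2 * ((1 / 2 : NNReal) : ℝ)) = 1 := by simp
    rw [this, h3, neg_add, Real.exp_add]
    have h4 : (√Real.pi)⁻¹ * (√Real.pi)⁻¹ = Real.pi⁻¹ := by
      rw [← mul_inv, Real.mul_self_sqrt Real.pi_pos.le]
    rw [← h4]
    ring_nf
  simp only [Pi.mul_apply, h2]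
  rw [← Measure.volume_eq_prod, ← lintegral_comp_polarCoord_symm, polarCoord_target,
    Measure.volume_eq_prod, ← Measure.prod_restrict, lintegral_prod _ (by
      simp only [polarCoord_symm_apply]
      fun_prop)]
  have h5 : ∀ r θ : ℝ, (r * Real.cos θ) ^ 2 + (r * Real.sin θ) ^ 2 = r ^ 2 := fun r θ => by
    rw [mul_pow, mul_pow, ← mul_add, Real.cos_sq_add_sin_sq, mul_one]
  simp only [polarCoord_symm_apply, h5, lintegral_const, Measure.restrict_apply MeasurableSet.univ,
    Set.univ_inter, Real.volume_Ioo]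
  have himg : (fun r : ℝ => r ^ 2) '' Set.Ioi 0 = Set.Ioi 0 := by
    ext t
    constructor
    · rintro ⟨r, hr, rfl⟩
      exact pow_pos (Set.mem_Ioi.1 hr) 2
    · intro ht
      exact ⟨√t, Real.sqrt_pos.2 ht, Real.sq_sqrt (le_of_lt ht)⟩
  conv_rhs => rw [← himg]
  rw [lintegral_image_eq_lintegral_abs_deriv_mul (f' := fun r => 2 * r) measurableSet_Ioi
    (fun r _ => by simpa using (hasDerivAt_pow 2 r).hasDerivWithinAt)
    (fun a ha b hb hab => by
      exact (pow_left_inj₀ (le_of_lt ha) (le_of_lt hb) two_ne_zero).1 hab)]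
  refine setLIntegral_congr_fun measurableSet_Ioi fun r hr => ?_
  have hr' : 0 < r := hr
  simp only [smul_eq_mul]
  have h6 : ENNReal.ofReal r * ENNReal.ofReal (Real.pi⁻¹ * Real.exp (-r ^ 2)) *
      ENNReal.ofReal (Real.pi - -Real.pi) =
      ENNReal.ofReal |2 * r| * ENNReal.ofReal (Real.exp (-r ^ 2)) := by
    rw [← ENNReal.ofReal_mul hr'.le, ← ENNReal.ofReal_mul (by positivity),
      ← ENNReal.ofReal_mul (abs_nonneg _), abs_of_pos (by positivity)]
    congr 1
    field_simp
    ring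
  rw [← mul_assoc (ENNReal.ofReal |2 * r|), ← h6]
  ring

theorem map_sq_add_sq_gaussian :
    ((gaussianReal 0 (1 / 2)).prod (gaussianReal 0 (1 / 2))).map (fun p : ℝ × ℝ => p.1 ^ 2 + p.2 ^ 2) =
      expLaw := by
  refine Measure.ext_of_lintegral _ fun φ hφ => ?_
  rw [lintegral_map hφ (by fun_prop), lintegral_gaussian_sq_add_sq hφ]

instance : IsProbabilityMeasure expLaw := by
  rw [← map_sq_add_sq_gaussian]
  exact Measure.isProbabilityMeasure_map (by fun_prop)

theorem complexGaussian_map_norm_sq (ι : Type*) [Fintype ι] :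
    (complexGaussian ι).map (fun w j => ‖w j‖ ^ 2) = Measure.pi fun _ => expLaw := by
  have h1 : MeasurePreserving (fun (p : ι → ℝ × ℝ) j => (p j).1 ^ 2 + (p j).2 ^ 2)
      (Measure.pi fun _ : ι => (gaussianReal 0 (1 / 2)).prod (gaussianReal 0 (1 / 2)))
      (Measure.pi fun _ => expLaw) := by
    refine ⟨by fun_prop, ?_⟩
    have : ∀ i : ι, SigmaFinite (((gaussianReal 0 (1 / 2)).prod (gaussianReal 0 (1 / 2))).map
      (fun p : ℝ × ℝ => p.1 ^ 2 + p.2 ^ 2)) := fun i => by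
        rw [map_sq_add_sq_gaussian]; infer_instance
    rw [← map_sq_add_sq_gaussian, ← Measure.pi_map_pi (fun _ => by fun_prop)]
  have h2 := (measurePreserving_arrowProdEquivProdArrow ℝ ℝ ι (fun _ => gaussianReal 0 (1 / 2))
    (fun _ => gaussianReal 0 (1 / 2))).symm
  have h3 := measurePreserving_sumPiEquivProdPi (X := fun _ : ι ⊕ ι => ℝ)
    (fun _ => gaussianReal 0 (1 / 2))
  rw [complexGaussian, Measure.map_map (by fun_prop) measurable_toComplexVec]
  rw [← ((h1.comp h2).comp h3).map_eq]
  congr 1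
  ext z j
  simp only [Function.comp_apply, Complex.sq_norm, Complex.normSq_apply, toComplexVec, ← sq]
  rfl

theorem measurePreserving_comp_perm {ι α : Type*} [Fintype ι] [MeasurableSpace α] (μ : Measure α)
    [SigmaFinite μ] (σ : Equiv.Perm ι) :
    MeasurePreserving (fun x : ι → α => x ∘ σ) (Measure.pi fun _ => μ) (Measure.pi fun _ => μ) := by
  have hm : Measurable (fun x : ι → α => x ∘ σ) :=
    measurable_pi_lambda _ fun i => measurable_pi_apply (σ i)
  refine ⟨hm, (Measure.pi_eq fun s hs => ?_).symm⟩
  have h : (fun x : ι → α => x ∘ σ) ⁻¹' Set.univ.pi s = Set.univ.pi fun i => s (σ.symm i) := by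
    ext x
    simp only [Set.mem_preimage, Set.mem_pi, Set.mem_univ, true_imp_iff, Function.comp_apply]
    exact ⟨fun hx i => by simpa using hx (σ.symm i), fun hx i => by simpa using hx (σ i)⟩
  rw [Measure.map_apply hm (MeasurableSet.univ_pi hs), h, Measure.pi_pi]
  exact Equiv.prod_comp σ.symm fun i => μ (s i)

theorem lintegral_fin_prod_eq_prod {n : ℕ} {α : Type*} [MeasurableSpace α] (μ : Measure α)
    [SigmaFinite μ] {f : Fin n → α → ENNReal} (hf : ∀ i, Measurable (f i)) :
    ∫⁻ x, ∏ i, f i (x i) ∂(Measure.pi fun _ => μ) = ∏ i, ∫⁻ t, f i t ∂μ := by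
  induction n with
  | zero => simp
  | succ n ih =>
    have h := measurePreserving_piFinSuccAbove (fun _ : Fin (n + 1) => μ) 0
    rw [← h.symm.lintegral_comp (by fun_prop), Fin.prod_univ_succ, ← ih fun i => hf i.succ,
      ← lintegral_prod_mul (hf 0).aemeasurable (Finset.measurable_fun_prod _ fun i _ =>
        (hf i.succ).comp (measurable_pi_apply i)).aemeasurable]
    refine lintegral_congr fun p => ?_
    rw [Fin.prod_univ_succ]
    rfl

theorem pi_withDensity {n : ℕ} {α : Type*} [MeasurableSpace α] (μ : Measure α) [SigmaFinite μ]
    {ρ : α → ENNReal} (hρ : Measurable ρ) [SigmaFinite (μ.withDensity ρ)] :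
    (Measure.pi fun _ : Fin n => μ.withDensity ρ) =
      (Measure.pi fun _ => μ).withDensity fun x => ∏ i, ρ (x i) := by
  refine Measure.pi_eq fun s hs => ?_
  rw [withDensity_apply _ (MeasurableSet.univ_pi hs), ← lintegral_indicator
    (MeasurableSet.univ_pi hs)]
  have h : ∀ x : Fin n → α, (Set.univ.pi s).indicator (fun x => ∏ i, ρ (x i)) x =
      ∏ i, (s i).indicator ρ (x i) := by
    intro x
    by_cases hx : x ∈ Set.univ.pi s
    · rw [Set.indicator_of_mem hx]
      exact Finset.prod_congr rfl fun i _ => (Set.indicator_of_mem (hx i (Set.mem_univ i)) _).symm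
    · rw [Set.indicator_of_notMem hx]
      simp only [Set.mem_pi, Set.mem_univ, true_imp_iff, not_forall] at hx
      obtain ⟨i, hi⟩ := hx
      exact (Finset.prod_eq_zero (Finset.mem_univ i) (Set.indicator_of_notMem hi _)).symm
  simp only [h]
  rw [lintegral_fin_prod_eq_prod μ fun i => hρ.indicator (hs i)]
  refine Finset.prod_congr rfl fun i _ => ?_
  rw [lintegral_indicator (hs i), withDensity_apply _ (hs i)]

theorem lintegral_pi_expLaw_prod_gaussian {n : ℕ} {F : (Fin n → ℝ) × ℝ → ENNReal}
    (hF : Measurable F) :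
    ∫⁻ p, F p ∂((Measure.pi fun _ => expLaw).prod (gaussianReal 0 1)) =
      ENNReal.ofReal (√(2 * Real.pi))⁻¹ *
        ∫⁻ z in {z : Fin (n + 1) → ℝ | ∀ j : Fin n, 0 < z j.castSucc},
          F (fun j => z j.castSucc, z (Fin.last n)) *
          ENNReal.ofReal (Real.exp (-(∑ j : Fin n, z j.castSucc) - z (Fin.last n) ^ 2 / 2)) := by
  set ρ : ℝ → ENNReal := (Set.Ioi 0).indicator fun t => ENNReal.ofReal (Real.exp (-t)) with hρ
  have hρm : Measurable ρ := measurable_expLaw_density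
  have hS : SigmaFinite (volume.withDensity ρ) := inferInstanceAs (SigmaFinite expLaw)
  have hm1 : Measurable fun x : Fin n → ℝ => ∏ i, ρ (x i) := by fun_prop
  have hset : MeasurableSet {z : Fin (n + 1) → ℝ | ∀ j : Fin n, 0 < z j.castSucc} := by
    simp only [Set.ofPred_forall]
    exact MeasurableSet.iInter fun j => measurableSet_lt measurable_const (measurable_pi_apply _)
  have h := volume_preserving_piFinSuccAbove (fun _ : Fin (n + 1) => ℝ) (Fin.last n)
  have hswap : MeasurePreserving Prod.swap ((volume : Measure ℝ).prod (volume : Measure (Fin n → ℝ)))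
    ((volume : Measure (Fin n → ℝ)).prod volume) := Measure.measurePreserving_swap
  have h1 := hswap.comp h
  have hlhs : (Measure.pi fun _ : Fin n => expLaw).prod (gaussianReal 0 1) =
      (volume.prod volume).withDensity
        fun p : (Fin n → ℝ) × ℝ => (∏ i, ρ (p.1 i)) * gaussianPDF 0 1 p.2 := by
    rw [expLaw, pi_withDensity _ hρm, gaussianReal_of_var_ne_zero _ one_ne_zero,
      prod_withDensity hm1 (measurable_gaussianPDF _ _)]
    rfl
  have hm2 : Measurable fun p : (Fin n → ℝ) × ℝ => (∏ i, ρ (p.1 i)) * gaussianPDF 0 1 p.2 :=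
    (hm1.comp measurable_fst).mul ((measurable_gaussianPDF _ _).comp measurable_snd)
  rw [hlhs, lintegral_withDensity_eq_lintegral_mul _ hm2 hF, ← h1.lintegral_comp (hm2.mul hF),
    ← lintegral_const_mul' _ _ ENNReal.ofReal_ne_top, ← lintegral_indicator hset]
  refine lintegral_congr fun z => ?_
  have hz : (Prod.swap ∘ (MeasurableEquiv.piFinSuccAbove (fun _ : Fin (n + 1) => ℝ) (Fin.last n))) z =
      (fun j : Fin n => z j.castSucc, z (Fin.last n)) := by
    simp [MeasurableEquiv.piFinSuccAbove, Fin.insertNthEquiv]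
    rfl
  rw [hz]
  simp only [Pi.mul_apply]
  by_cases hpos : ∀ j : Fin n, 0 < z j.castSucc
  · rw [Set.indicator_of_mem (show z ∈ {z : Fin (n + 1) → ℝ | ∀ j : Fin n, 0 < z j.castSucc}
      from hpos)]
    have h3 : ∏ i : Fin n, ρ (z i.castSucc) =
        ENNReal.ofReal (Real.exp (-∑ j : Fin n, z j.castSucc)) := by
      rw [← Finset.sum_neg_distrib, Real.exp_sum, ENNReal.ofReal_prod_of_nonneg
        fun i _ => (Real.exp_pos _).le]
      exact Finset.prod_congr rfl fun i _ => Set.indicator_of_mem (Set.mem_Ioi.2 (hpos i)) _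
    have h4 : gaussianPDF 0 1 (z (Fin.last n)) = ENNReal.ofReal (√(2 * Real.pi))⁻¹ *
        ENNReal.ofReal (Real.exp (-(z (Fin.last n) ^ 2 / 2))) := by
      rw [gaussianPDF, gaussianPDFReal, ← ENNReal.ofReal_mul (by positivity)]
      simp [neg_div]
    rw [h3, h4, sub_eq_add_neg, Real.exp_add, ENNReal.ofReal_mul (Real.exp_pos _).le]
    ring
  · rw [Set.indicator_of_notMem (show z ∉ {z : Fin (n + 1) → ℝ | ∀ j : Fin n, 0 < z j.castSucc}
      from hpos)]
    push Not at hpos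
    obtain ⟨j, hj⟩ := hpos
    have hj0 : ρ (z j.castSucc) = 0 := Set.indicator_of_notMem (by simpa using hj) _
    rw [Finset.prod_eq_zero (Finset.mem_univ j) hj0, zero_mul, zero_mul]

/-! ### The transition kernel from `x` to `y` -/

/-- The mean of `φ` over the eigenvalues of the bordered matrix with upper left block
`diagonal x`, standard complex Gaussian border and standard Gaussian corner entry. -/
noncomputable def borderMean {n : ℕ} (φ : (Fin (n + 1) → ℝ) → ENNReal) (x : Fin n → ℝ) : ENNReal :=
  ∫⁻ p : (Fin n → ℝ) × ℝ, φ (borderRoots x p.1 p.2)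
    ∂((Measure.pi fun _ => expLaw).prod (gaussianReal 0 1))

theorem measurable_borderMean {n : ℕ} {φ : (Fin (n + 1) → ℝ) → ENNReal} (hφ : Measurable φ) :
    Measurable (borderMean φ) := by
  have h : Measurable fun p : (Fin n → ℝ) × (Fin n → ℝ) × ℝ =>
    φ (borderRoots p.1 p.2.1 p.2.2) := hφ.comp measurable_borderRoots
  exact h.lintegral_prod_right'

theorem measurable_comp_borderRoots {n : ℕ} {φ : (Fin (n + 1) → ℝ) → ENNReal} (hφ : Measurable φ)
    (x : Fin n → ℝ) : Measurable fun p : (Fin n → ℝ) × ℝ => φ (borderRoots x p.1 p.2) := by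
  have hx : Measurable fun p : (Fin n → ℝ) × ℝ => (x, p) :=
    measurable_const.prodMk measurable_id
  generalize hg : (fun p : (Fin n → ℝ) × (Fin n → ℝ) × ℝ => φ (borderRoots p.1 p.2.1 p.2.2)) = g
  have hgm : Measurable g := by subst hg; exact hφ.comp measurable_borderRoots
  have h := hgm.comp hx
  have hcomp : g ∘ (fun p : (Fin n → ℝ) × ℝ => (x, p)) =
      fun p : (Fin n → ℝ) × ℝ => φ (borderRoots x p.1 p.2) := by
    subst hg; rfl
  rwa [hcomp] at h

theorem isSymmFun_borderMean {n : ℕ} {φ : (Fin (n + 1) → ℝ) → ENNReal} (hφ : IsSymmFun φ)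
    (hm : Measurable φ) : IsSymmFun (borderMean φ) := by
  intro σ x
  have h := (measurePreserving_comp_perm expLaw σ).prod (MeasurePreserving.id (gaussianReal 0 1))
  have hmx := measurable_comp_borderRoots hm (x ∘ σ)
  rw [borderMean, ← h.lintegral_comp hmx]
  exact lintegral_congr fun p => hφ.borderRoots_comp_perm x p.1 p.2 σ

theorem borderMean_eq {n : ℕ} {φ : (Fin (n + 1) → ℝ) → ENNReal} (hφ : IsSymmFun φ)
    (hm : Measurable φ) {x : Fin n → ℝ} (hx : StrictMono x) :
    borderMean φ x = ENNReal.ofReal (√(2 * Real.pi))⁻¹ *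
      ∫⁻ y in {y | Interlace x y}, φ y * ENNReal.ofReal
        ((Matrix.vandermonde y).det / (Matrix.vandermonde x).det *
          Real.exp (-(∑ k, y k ^ 2) / 2 + (∑ j, x j ^ 2) / 2)) := by
  have hmx := measurable_comp_borderRoots hm x
  rw [borderMean, lintegral_pi_expLaw_prod_gaussian hmx, setLIntegral_borderRoots hx hφ]

/-! ### Laws of unordered eigenvalues -/

theorem lintegral_eigenvalueLaw {Ω : Type*} [MeasurableSpace Ω] {μ : Measure Ω} {n : ℕ}
    {M : Ω → Matrix (Fin n) (Fin n) ℂ} {hM : ∀ ω, (M ω).IsHermitian}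
    (hm : AEMeasurable (fun ω => (hM ω).eigenvalues) μ) {φ : (Fin n → ℝ) → ENNReal}
    (hφ : IsSymmFun φ) (hφm : Measurable φ) :
    ∫⁻ x, φ x ∂(eigenvalueLaw μ M hM) = ∫⁻ ω, φ (hM ω).eigenvalues ∂μ := by
  rw [eigenvalueLaw, lintegral_smul_measure, lintegral_finsetSum_measure]
  have h : ∀ σ : Equiv.Perm (Fin n),
      ∫⁻ x, φ x ∂(μ.map fun ω i => (hM ω).eigenvalues (σ i)) =
        ∫⁻ ω, φ (hM ω).eigenvalues ∂μ := by
    intro σ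
    have hσ : AEMeasurable (fun ω i => (hM ω).eigenvalues (σ i)) μ :=
      aemeasurable_pi_lambda _ fun i => (measurable_pi_apply (σ i)).comp_aemeasurable hm
    rw [lintegral_map' hφm.aemeasurable hσ]
    exact lintegral_congr fun ω => hφ σ (hM ω).eigenvalues
  simp only [h, Finset.sum_const, Finset.card_univ, Fintype.card_perm, Fintype.card_fin,
    nsmul_eq_mul, smul_eq_mul]
  rw [← mul_assoc, ENNReal.inv_mul_cancel (by simp [Nat.factorial_ne_zero]) (by simp), one_mul]

theorem eigenvalueLaw_map_comp_perm {Ω : Type*} [MeasurableSpace Ω] {μ : Measure Ω} {n : ℕ}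
    {M : Ω → Matrix (Fin n) (Fin n) ℂ} {hM : ∀ ω, (M ω).IsHermitian}
    (hm : AEMeasurable (fun ω => (hM ω).eigenvalues) μ) (τ : Equiv.Perm (Fin n)) :
    (eigenvalueLaw μ M hM).map (fun x => x ∘ τ) = eigenvalueLaw μ M hM := by
  have hτ : Measurable (fun x : Fin n → ℝ => x ∘ τ) :=
    measurable_pi_lambda _ fun i => measurable_pi_apply (τ i)
  rw [eigenvalueLaw, Measure.map_smul, ← Measure.mapₗ_apply_of_measurable hτ, map_sum]
  congr 1
  rw [← Equiv.sum_comp (Equiv.mulRight τ) fun σ => μ.map fun ω i => (hM ω).eigenvalues (σ i)]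
  refine Finset.sum_congr rfl fun σ _ => ?_
  have hσ : AEMeasurable (fun ω i => (hM ω).eigenvalues (σ i)) μ :=
    aemeasurable_pi_lambda _ fun i => (measurable_pi_apply (σ i)).comp_aemeasurable hm
  rw [Measure.mapₗ_apply_of_measurable hτ, AEMeasurable.map_map_of_aemeasurable hτ.aemeasurable hσ]
  rfl

/-- Summing a test function over all permutations makes it symmetric and multiplies its integral
against an invariant measure by `n!`. -/
theorem measure_ext_of_isSymmFun {n : ℕ} {μ ν : Measure (Fin n → ℝ)}
    (hμ : ∀ τ : Equiv.Perm (Fin n), μ.map (fun x => x ∘ τ) = μ)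
    (hν : ∀ τ : Equiv.Perm (Fin n), ν.map (fun x => x ∘ τ) = ν)
    (h : ∀ φ : (Fin n → ℝ) → ENNReal, IsSymmFun φ → Measurable φ → ∫⁻ x, φ x ∂μ = ∫⁻ x, φ x ∂ν) :
    μ = ν := by
  refine Measure.ext_of_lintegral _ fun ψ hψ => ?_
  have hτ : ∀ τ : Equiv.Perm (Fin n), Measurable (fun x : Fin n → ℝ => x ∘ τ) := fun τ =>
    measurable_pi_lambda _ fun i => measurable_pi_apply (τ i)
  set φ : (Fin n → ℝ) → ENNReal := fun x => ∑ τ : Equiv.Perm (Fin n), ψ (x ∘ τ) with hφ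
  have hφs : IsSymmFun φ := fun σ x => Equiv.sum_comp (Equiv.mulLeft σ) fun τ => ψ (x ∘ τ)
  have hφm : Measurable φ := Finset.measurable_fun_sum _ fun τ _ => hψ.comp (hτ τ)
  have key : ∀ κ : Measure (Fin n → ℝ), (∀ τ : Equiv.Perm (Fin n), κ.map (fun x => x ∘ τ) = κ) →
      ∫⁻ x, φ x ∂κ = n.factorial * ∫⁻ x, ψ x ∂κ := by
    intro κ hκ
    have hψτ : ∀ τ : Equiv.Perm (Fin n), Measurable fun x => ψ (x ∘ τ) := fun τ => hψ.comp (hτ τ)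
    rw [hφ, lintegral_finsetSum _ fun τ _ => hψτ τ]
    have : ∀ τ : Equiv.Perm (Fin n), ∫⁻ x, ψ (x ∘ τ) ∂κ = ∫⁻ x, ψ x ∂κ := fun τ => by
      rw [← lintegral_map hψ (hτ τ), hκ τ]
    simp [this, Fintype.card_perm]
  have h1 := h φ hφs hφm
  rw [key μ hμ, key ν hν] at h1
  exact (ENNReal.mul_right_inj (by simp [Nat.factorial_ne_zero]) (by simp)).1 h1

/-- The Hermitian part of a complex matrix. -/
noncomputable def hermitianPart {n : ℕ} (A : Fin n → Fin n → ℂ) : Matrix (Fin n) (Fin n) ℂ :=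
  Matrix.of fun i j => (A i j + star (A j i)) / 2

/-- Independence leads to a product measure on all matrices, not only the Hermitian ones. Passing
through the Hermitian part makes the eigenvalues a function of every matrix without changing them
for Hermitian ones. -/
theorem isHermitian_hermitianPart {n : ℕ} (A : Fin n → Fin n → ℂ) :
    (hermitianPart A).IsHermitian := by
  ext i j
  simp [hermitianPart, Matrix.conjTranspose_apply, add_comm]

theorem hermitianPart_eq {n : ℕ} {A : Matrix (Fin n) (Fin n) ℂ} (hA : A.IsHermitian) :
    hermitianPart A = A := by
  ext i j
  simp only [hermitianPart, Matrix.of_apply, hA.apply]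
  ring

theorem measurable_hermitianPart {n : ℕ} (i j : Fin n) :
    Measurable fun A : Fin n → Fin n → ℂ => hermitianPart A i j := by
  have h : ∀ i j : Fin n, Measurable fun A : Fin n → Fin n → ℂ => A i j := fun i j =>
    (measurable_pi_apply j).comp (measurable_pi_apply i)
  exact ((h i j).add (Complex.continuous_conj.measurable.comp (h j i))).div_const 2

/-- The eigenvalues of the bordered matrix, as a function of all the entries. -/
noncomputable def extendEigenvalues {n : ℕ} (p : (Fin n → Fin n → ℂ) × (Fin n → ℂ) × ℝ) :
    Fin (n + 1) → ℝ :=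
  (extend_isHermitian (isHermitian_hermitianPart p.1) p.2.1 p.2.2).eigenvalues

theorem measurable_extendEigenvalues {n : ℕ} : Measurable (extendEigenvalues (n := n)) :=
  measurable_eigenvalues _ (measurable_extend_apply
    (fun i j => (measurable_hermitianPart i j).comp measurable_fst)
    (measurable_fst.comp measurable_snd) (measurable_snd.comp measurable_snd))

/-- The matrix is fixed here, so the diagonalising unitary is a constant and is absorbed by the
invariance of the Gaussian law. No measurable choice of eigenvectors in `A` is required. -/
theorem lintegral_extendEigenvalues {n : ℕ} {φ : (Fin (n + 1) → ℝ) → ENNReal} (hφ : IsSymmFun φ)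
    (hm : Measurable φ) (A : Fin n → Fin n → ℂ) :
    ∫⁻ q, φ (extendEigenvalues (A, q)) ∂((complexGaussian (Fin n)).prod (gaussianReal 0 1)) =
      borderMean φ (isHermitian_hermitianPart A).eigenvalues := by
  set hA := isHermitian_hermitianPart A
  set U : Matrix (Fin n) (Fin n) ℂ := star hA.eigenvectorUnitary.1 with hU
  have hUU : star U * U = 1 := by rw [hU, star_star]; exact Unitary.coe_mul_star_self _
  have hUm : Measurable U.mulVec := by
    refine measurable_pi_lambda _ fun i => ?_
    simp only [Matrix.mulVec, dotProduct]
    fun_prop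
  have h1 : MeasurePreserving U.mulVec (complexGaussian (Fin n)) (complexGaussian (Fin n)) :=
    ⟨hUm, complexGaussian_map_mulVec hUU⟩
  have h2 : MeasurePreserving (fun (w : Fin n → ℂ) j => ‖w j‖ ^ 2) (complexGaussian (Fin n))
      (Measure.pi fun _ => expLaw) := ⟨by fun_prop, complexGaussian_map_norm_sq _⟩
  have h3 := (h2.comp h1).prod (MeasurePreserving.id (gaussianReal 0 1))
  rw [borderMean, ← h3.lintegral_comp (measurable_comp_borderRoots hm _)]
  exact lintegral_congr fun q => hφ.eigenvalues_extend hA q.1 q.2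

theorem eigenvalues_congr {n : ℕ} {A B : Matrix (Fin n) (Fin n) ℂ} (hA : A.IsHermitian)
    (hB : B.IsHermitian) (h : A = B) : hA.eigenvalues = hB.eigenvalues := by
  subst h; rfl

theorem eigenvalues_extend_eq {n : ℕ} {A : Matrix (Fin n) (Fin n) ℂ} (hA : A.IsHermitian)
    (v : Fin n → ℂ) (c : ℝ) :
    (extend_isHermitian hA v c).eigenvalues = extendEigenvalues (Matrix.of.symm A, v, c) := by
  apply eigenvalues_congr
  have := hermitianPart_eq hA
  exact congrArg (fun B => extend B v c) this.symm

section

variable {Ω : Type*} [MeasurableSpace Ω] {μ : Measure Ω} {n : ℕ}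
  {X : Ω → Matrix (Fin n) (Fin n) ℂ} {v : Ω → Fin n → ℂ} {c : Ω → ℝ}

theorem aemeasurable_eigenvalues_extend (hX : ∀ ω, (X ω).IsHermitian)
    (hXm : ∀ i j, Measurable (fun ω => X ω i j)) (hvc : AEMeasurable (fun ω => (v ω, c ω)) μ) :
    AEMeasurable (fun ω => (extend_isHermitian (hX ω) (v ω) (c ω)).eigenvalues) μ := by
  have hXm' : Measurable fun ω => Matrix.of.symm (X ω) :=
    measurable_pi_lambda _ fun i => measurable_pi_lambda _ fun j => hXm i j
  have h : (fun ω => (extend_isHermitian (hX ω) (v ω) (c ω)).eigenvalues) =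
      fun ω => extendEigenvalues (Matrix.of.symm (X ω), v ω, c ω) :=
    funext fun ω => eigenvalues_extend_eq (hX ω) (v ω) (c ω)
  rw [h]
  exact measurable_extendEigenvalues.comp_aemeasurable (hXm'.aemeasurable.prodMk hvc)

theorem lintegral_eigenvalueLaw_extend [IsProbabilityMeasure μ] (hX : ∀ ω, (X ω).IsHermitian)
    (hXm : ∀ i j, Measurable (fun ω => X ω i j)) (hvc : AEMeasurable (fun ω => (v ω, c ω)) μ)
    (hlaw : μ.map (fun ω => (v ω, c ω)) = (complexGaussian (Fin n)).prod (gaussianReal 0 1))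
    (hXindep : IndepFun (fun ω (i j : Fin n) => X ω i j) (fun ω => (v ω, c ω)) μ)
    {φ : (Fin (n + 1) → ℝ) → ENNReal} (hφ : IsSymmFun φ) (hm : Measurable φ) :
    ∫⁻ y, φ y ∂(eigenvalueLaw μ (fun ω => extend (X ω) (v ω) (c ω))
      fun ω => extend_isHermitian (hX ω) (v ω) (c ω)) =
      ∫⁻ x, borderMean φ x ∂(eigenvalueLaw μ X hX) := by
  have hXm' : Measurable fun ω => Matrix.of.symm (X ω) :=
    measurable_pi_lambda _ fun i => measurable_pi_lambda _ fun j => hXm i j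
  rw [lintegral_eigenvalueLaw (aemeasurable_eigenvalues_extend hX hXm hvc) hφ hm,
    lintegral_eigenvalueLaw (measurable_eigenvalues hX hXm).aemeasurable
      (isSymmFun_borderMean hφ hm) (measurable_borderMean hm)]
  have hE : Measurable fun p => φ (extendEigenvalues (n := n) p) :=
    hm.comp measurable_extendEigenvalues
  have h1 : ∫⁻ ω, φ (extend_isHermitian (hX ω) (v ω) (c ω)).eigenvalues ∂μ =
      ∫⁻ p, φ (extendEigenvalues p)
        ∂(μ.map fun ω => (Matrix.of.symm (X ω), (v ω, c ω))) := by
    rw [lintegral_map' hE.aemeasurable (hXm'.aemeasurable.prodMk hvc)]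
    exact lintegral_congr fun ω => by rw [eigenvalues_extend_eq (hX ω)]
  rw [h1, (indepFun_iff_map_prod_eq_prod_map_map hXm'.aemeasurable hvc).1 hXindep, hlaw,
    lintegral_prod _ hE.aemeasurable]
  simp only [lintegral_extendEigenvalues hφ hm]
  have h2 : Measurable fun A : Fin n → Fin n → ℂ =>
      borderMean φ (isHermitian_hermitianPart A).eigenvalues :=
    (measurable_borderMean hm).comp (measurable_eigenvalues _ measurable_hermitianPart)
  rw [lintegral_map h2 hXm']
  refine lintegral_congr fun ω => ?_
  exact congrArg _ (eigenvalues_congr _ _ (hermitianPart_eq (hX ω)))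

end

/-! ### Reduction to increasing tuples -/

theorem volume_not_injective (n : ℕ) :
    volume {x : Fin n → ℝ | ¬ Function.Injective x} = 0 := by
  have h : {x : Fin n → ℝ | ¬ Function.Injective x} ⊆
      ⋃ p : {p : Fin n × Fin n // p.1 ≠ p.2}, {x | x p.1.1 = x p.1.2} := by
    intro x hx
    simp only [Function.Injective, not_forall, Set.mem_ofPred_eq] at hx
    obtain ⟨i, j, hij, hne⟩ := hx
    exact Set.mem_iUnion.2 ⟨⟨(i, j), hne⟩, hij⟩
  refine measure_mono_null h (measure_iUnion_null fun p => ?_)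
  obtain ⟨⟨i, j⟩, hne⟩ := p
  set L : (Fin n → ℝ) →ₗ[ℝ] ℝ := LinearMap.proj (R := ℝ) (φ := fun _ : Fin n => ℝ) i -
    LinearMap.proj (R := ℝ) (φ := fun _ : Fin n => ℝ) j with hL
  have hker : {x : Fin n → ℝ | x i = x j} = (LinearMap.ker L : Set (Fin n → ℝ)) := by
    ext x
    simp [hL, sub_eq_zero]
  simp only [hker]
  apply Measure.addHaar_submodule
  intro htop
  have : L (Pi.single i 1) = 0 := by
    rw [← LinearMap.mem_ker, htop]; trivial
  simp [hL, Pi.single_eq_of_ne hne.symm] at this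

theorem measurableSet_strictMono (n : ℕ) : MeasurableSet {x : Fin n → ℝ | StrictMono x} := by
  simp only [StrictMono, Set.ofPred_forall]
  exact MeasurableSet.iInter fun i => MeasurableSet.iInter fun j => MeasurableSet.iInter fun _ =>
    measurableSet_lt (measurable_pi_apply i) (measurable_pi_apply j)

/-- Off the null set of tuples with repeated entries, space splits into `n!` chambers, permuted by
maps that preserve both `F` and the volume. -/
theorem lintegral_eq_factorial_mul {n : ℕ} {F : (Fin n → ℝ) → ENNReal} (hF : IsSymmFun F) :
    ∫⁻ x, F x = n.factorial * ∫⁻ x in {x | StrictMono x}, F x := by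
  set S : Equiv.Perm (Fin n) → Set (Fin n → ℝ) := fun σ => {x | StrictMono (x ∘ σ)} with hS
  have hmeas : ∀ σ : Equiv.Perm (Fin n), Measurable (fun x : Fin n → ℝ => x ∘ σ) := fun σ =>
    measurable_pi_lambda _ fun i => measurable_pi_apply (σ i)
  have hSm : ∀ σ, MeasurableSet (S σ) := fun σ => hmeas σ (measurableSet_strictMono n)
  have hdisj : Pairwise (Function.onFun Disjoint S) := by
    intro σ τ hστ
    rw [Function.onFun, Set.disjoint_left]
    intro x hσ hτ
    apply hστ
    have h1 := Tuple.unique_monotone (f := x) (σ := σ) (τ := τ) (StrictMono.monotone hσ)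
      (StrictMono.monotone hτ)
    have hinj : Function.Injective x := by
      have := (StrictMono.injective hσ).comp σ.symm.injective
      rwa [Function.comp_assoc, Equiv.self_comp_symm, Function.comp_id] at this
    exact Equiv.ext fun i => hinj (congrFun h1 i)
  have hcover : (⋃ σ, S σ) =ᵐ[volume] Set.univ := by
    rw [ae_eq_univ]
    refine measure_mono_null (fun x hx => ?_) (volume_not_injective n)
    intro hinj
    apply hx
    refine Set.mem_iUnion.2 ⟨Tuple.sort x, ?_⟩
    exact (Tuple.monotone_sort x).strictMono_of_injective (hinj.comp (Tuple.sort x).injective)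
  have hperm : ∀ σ, ∫⁻ x in S σ, F x = ∫⁻ x in {x | StrictMono x}, F x := by
    intro σ
    let e : (Fin n → ℝ) ≃ᵐ (Fin n → ℝ) :=
      { toFun := fun x => x ∘ σ
        invFun := fun x => x ∘ σ.symm
        left_inv := fun x => by ext; simp
        right_inv := fun x => by ext; simp
        measurable_toFun := hmeas σ
        measurable_invFun := hmeas σ.symm }
    have hp : MeasurePreserving e volume volume := measurePreserving_comp_perm volume σ
    rw [← hp.setLIntegral_comp_preimage_emb e.measurableEmbedding F {x | StrictMono x}]
    exact lintegral_congr fun x => (hF σ x).symm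
  rw [← setLIntegral_univ, ← setLIntegral_congr hcover, lintegral_iUnion hSm hdisj]
  simp [hperm, Fintype.card_perm]

/-! ### Determinants integrated over the interlacing region -/

theorem det_of_comp_perm {n : ℕ} (f : Fin n → ℝ → ℝ) (x : Fin n → ℝ) (σ : Equiv.Perm (Fin n)) :
    (Matrix.of fun j k : Fin n => f k ((x ∘ σ) j)).det =
      Equiv.Perm.sign σ * (Matrix.of fun j k : Fin n => f k (x j)).det := by
  rw [← Matrix.det_permute]
  rfl

theorem isSymmFun_density {n : ℕ} (f : Fin n → ℝ → ℝ) (Z : ℝ) : IsSymmFun (density f Z) := by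
  intro σ x
  have h := det_of_comp_perm (fun k t => t ^ (k : ℕ)) x σ
  have h1 : ∀ x : Fin n → ℝ, Matrix.vandermonde x = Matrix.of fun j k : Fin n => x j ^ (k : ℕ) :=
    fun x => by ext; simp [Matrix.vandermonde_apply]
  have h2 : ((Equiv.Perm.sign σ : ℤ) : ℝ) * ((Equiv.Perm.sign σ : ℤ) : ℝ) = 1 := by
    norm_cast
    simp
  rw [density, density, h1, h1, h, det_of_comp_perm]
  calc _ = (((Equiv.Perm.sign σ : ℤ) : ℝ) * ((Equiv.Perm.sign σ : ℤ) : ℝ)) * (Z⁻¹ *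
        (Matrix.of fun j k : Fin n => x j ^ (k : ℕ)).det *
          (Matrix.of fun j k : Fin n => f k (x j)).det) := by ring
    _ = _ := by rw [h2, one_mul]

/-- Leibniz expansion and Fubini. Each row has its own measure, so every permutation keeps its own
product of integrals. -/
theorem det_of_integral {n : ℕ} (ν : Fin n → Measure ℝ) [∀ j, SigmaFinite (ν j)]
    {w : Fin n → ℝ → ℝ} (hw : ∀ j k, Integrable (w k) (ν j)) :
    Integrable (fun x : Fin n → ℝ => (Matrix.of fun j k => w k (x j)).det) (Measure.pi ν) ∧
    ∫ x, (Matrix.of fun j k => w k (x j)).det ∂(Measure.pi ν) =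
      (Matrix.of fun j k => ∫ t, w k t ∂(ν j)).det := by
  have hi : ∀ σ : Equiv.Perm (Fin n), Integrable
      (fun x : Fin n → ℝ => ((Equiv.Perm.sign σ : ℤ) : ℝ) * ∏ j, w (σ j) (x j)) (Measure.pi ν) :=
    fun σ => (Integrable.fintype_prod_dep fun j => hw j (σ j)).const_mul _
  have hd : ∀ M : Matrix (Fin n) (Fin n) ℝ, M.det =
      ∑ σ : Equiv.Perm (Fin n), ((Equiv.Perm.sign σ : ℤ) : ℝ) * ∏ j, M j (σ j) := fun M => by
    rw [← Matrix.det_transpose, Matrix.det_apply']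
    rfl
  simp only [hd, Matrix.of_apply]
  refine ⟨integrable_finsetSum _ fun σ _ => hi σ, ?_⟩
  rw [integral_finsetSum _ fun σ _ => hi σ]
  refine Finset.sum_congr rfl fun σ _ => ?_
  rw [integral_const_mul, integral_fintype_prod_eq_prod (fun j => w (σ j))]

/-- Once the Gaussian factors are taken out of the rows, the first column is constant. Subtracting
from each row its predecessor clears that column below the top and turns primitives into integrals
between consecutive `y j`; the base point `0` drops out. -/
theorem det_extendFun {n : ℕ} {f : Fin n → ℝ → ℝ}
    (hf : ∀ k a b, IntervalIntegrable (fun x => Real.exp (x ^ 2 / 2) * f k x) volume a b)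
    (y : Fin (n + 1) → ℝ) :
    (Matrix.of fun j k : Fin (n + 1) => extendFun f k (y j)).det =
      Real.exp (-(∑ j, y j ^ 2) / 2) * (Matrix.of fun j k : Fin n =>
        ∫ x in (y j.castSucc)..(y j.succ), Real.exp (x ^ 2 / 2) * f k x).det := by
  set P : Fin (n + 1) → ℝ → ℝ :=
    Fin.cons (fun _ => 1) fun k t => ∫ x in (0 : ℝ)..t, Real.exp (x ^ 2 / 2) * f k x with hP
  have h1 : (Matrix.of fun j k : Fin (n + 1) => extendFun f k (y j)) =
      Matrix.diagonal (fun j => Real.exp (-y j ^ 2 / 2)) *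
        Matrix.of fun j k : Fin (n + 1) => P k (y j) := by
    ext j k
    rw [Matrix.diagonal_mul]
    refine Fin.cases ?_ (fun k => ?_) k
    · simp [extendFun, hP]
    · simp [extendFun, hP]
  set B : Matrix (Fin (n + 1)) (Fin (n + 1)) ℝ :=
    Matrix.of (Fin.cons (fun k => P k (y 0)) fun (j : Fin n) k => P k (y j.succ) - P k (y j.castSucc))
    with hB
  have h2 : (Matrix.of fun j k : Fin (n + 1) => P k (y j)).det = B.det := by
    refine Matrix.det_eq_of_forall_row_eq_smul_add_pred (fun _ => 1) (fun k => ?_) fun j k => ?_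
    · simp [hB]
    · simp [hB]
  have h3 : B.det = (Matrix.of fun j k : Fin n =>
        ∫ x in (y j.castSucc)..(y j.succ), Real.exp (x ^ 2 / 2) * f k x).det := by
    rw [Matrix.det_succ_column_zero, Fin.sum_univ_succ, Finset.sum_eq_zero fun j _ => by
      simp [hB, hP]]
    have h4 : B 0 0 = 1 := by simp [hB, hP]
    rw [h4, Fin.val_zero, pow_zero, one_mul, one_mul, add_zero]
    congr 1
    ext j k
    simp only [hB, hP, Matrix.submatrix_apply, Matrix.of_apply, Fin.succAbove_zero, Fin.cons_succ]
    rw [intervalIntegral.integral_interval_sub_left (hf _ _ _) (hf _ _ _)]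
  rw [h1, Matrix.det_mul, Matrix.det_diagonal, h2, h3, ← Real.exp_sum, ← Finset.sum_div,
    Finset.sum_neg_distrib]

theorem det_exp_mul {n : ℕ} (f : Fin n → ℝ → ℝ) (x : Fin n → ℝ) :
    (Matrix.of fun j k : Fin n => Real.exp (x j ^ 2 / 2) * f k (x j)).det =
      Real.exp ((∑ j, x j ^ 2) / 2) * (Matrix.of fun j k : Fin n => f k (x j)).det := by
  have : (Matrix.of fun j k : Fin n => Real.exp (x j ^ 2 / 2) * f k (x j)) =
      Matrix.diagonal (fun j => Real.exp (x j ^ 2 / 2)) * Matrix.of fun j k : Fin n => f k (x j) := by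
    ext j k
    rw [Matrix.diagonal_mul]
    rfl
  rw [this, Matrix.det_mul, Matrix.det_diagonal, ← Real.exp_sum, Finset.sum_div]

theorem setOf_interlace_left {n : ℕ} (y : Fin (n + 1) → ℝ) :
    {x | Interlace x y} = Set.univ.pi fun j : Fin n => Set.Ioo (y j.castSucc) (y j.succ) := by
  ext x
  simp [Interlace, Set.mem_pi]

theorem IsPolynomialEnsemble.inv_mul_det_nonneg {n : ℕ} {f : Fin n → ℝ → ℝ} {Z : ℝ}
    (hf : IsPolynomialEnsemble f Z) {x : Fin n → ℝ} (hx : StrictMono x) :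
    0 ≤ Z⁻¹ * (Matrix.of fun j k : Fin n => f k (x j)).det := by
  have h := hf.nonneg x
  have hpos := det_vandermonde_pos hx
  rw [density, mul_right_comm] at h
  exact nonneg_of_mul_nonneg_left h hpos

theorem IsPolynomialEnsemble.integrable {n : ℕ} {f : Fin n → ℝ → ℝ} {Z : ℝ}
    (hf : IsPolynomialEnsemble f Z) (k : Fin n) : Integrable (f k) := by
  simpa using hf.integrable_moment ⟨0, k.pos⟩ k

theorem IsPolynomialEnsemble.intervalIntegrable {n : ℕ} {f : Fin n → ℝ → ℝ} {Z : ℝ}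
    (hf : IsPolynomialEnsemble f Z) (k : Fin n) (a b : ℝ) :
    IntervalIntegrable (fun x => Real.exp (x ^ 2 / 2) * f k x) volume a b :=
  (hf.integrable k).intervalIntegrable.continuousOn_mul (by fun_prop)

/-- For fixed `y` the region is a box, so `det_of_integral` and `det_extendFun` apply. The integrand
is nonnegative there, which gives the sign of the new determinant at every increasing `y`. -/
theorem IsPolynomialEnsemble.setLIntegral_interlace {n : ℕ} {f : Fin n → ℝ → ℝ} {Z : ℝ}
    (hf : IsPolynomialEnsemble f Z) {y : Fin (n + 1) → ℝ} (hy : StrictMono y) :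
    0 ≤ Z⁻¹ * (Matrix.of fun j k : Fin (n + 1) => extendFun f k (y j)).det ∧
    ∫⁻ x in {x | Interlace x y}, ENNReal.ofReal (Real.exp ((∑ j, x j ^ 2) / 2) *
        (Z⁻¹ * (Matrix.of fun j k : Fin n => f k (x j)).det)) =
      ENNReal.ofReal (Real.exp ((∑ j, y j ^ 2) / 2) *
        (Z⁻¹ * (Matrix.of fun j k : Fin (n + 1) => extendFun f k (y j)).det)) := by
  set ν : Fin n → Measure ℝ := fun j => volume.restrict (Set.Ioo (y j.castSucc) (y j.succ)) with hν
  have hle : ∀ j : Fin n, y j.castSucc ≤ y j.succ := fun j => hy.monotone Fin.castSucc_lt_succ.le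
  have hw : ∀ j k, Integrable (fun x => Real.exp (x ^ 2 / 2) * f k x) (ν j) := fun j k => by
    have := (intervalIntegrable_iff_integrableOn_Ioo_of_le (hle j)).1
      (hf.intervalIntegrable k (y j.castSucc) (y j.succ))
    exact this
  obtain ⟨hi, heq⟩ := det_of_integral ν hw
  have hpi : volume.restrict {x : Fin n → ℝ | Interlace x y} = Measure.pi ν := by
    rw [setOf_interlace_left, volume_pi, Measure.restrict_pi_pi]
  have hint : ∀ j k, ∫ t, Real.exp (t ^ 2 / 2) * f k t ∂(ν j) =
      ∫ x in (y j.castSucc)..(y j.succ), Real.exp (x ^ 2 / 2) * f k x := fun j k => by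
    rw [intervalIntegral.integral_of_le (hle j), hν, integral_Ioc_eq_integral_Ioo]
  have hms : MeasurableSet {x : Fin n → ℝ | Interlace x y} := by
    rw [setOf_interlace_left]
    exact MeasurableSet.univ_pi fun _ => measurableSet_Ioo
  simp only [hint, det_exp_mul] at heq hi
  have h1 : ∫ x in {x | Interlace x y}, Real.exp ((∑ j, x j ^ 2) / 2) *
        (Z⁻¹ * (Matrix.of fun j k : Fin n => f k (x j)).det) =
      Real.exp ((∑ j, y j ^ 2) / 2) *
        (Z⁻¹ * (Matrix.of fun j k : Fin (n + 1) => extendFun f k (y j)).det) := by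
    simp only [mul_left_comm _ Z⁻¹]
    rw [integral_const_mul, hpi, heq, det_extendFun hf.intervalIntegrable, ← mul_assoc (Real.exp _),
      ← Real.exp_add]
    simp [neg_div]
  have hnn : ∀ x ∈ {x : Fin n → ℝ | Interlace x y}, 0 ≤ Real.exp ((∑ j, x j ^ 2) / 2) *
        (Z⁻¹ * (Matrix.of fun j k : Fin n => f k (x j)).det) := fun x hx =>
    mul_nonneg (Real.exp_pos _).le
      (hf.inv_mul_det_nonneg (Interlace.strictMono_left (show Interlace x y from hx)))
  constructor
  · have := setIntegral_nonneg (μ := volume) hms hnn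
    rw [h1] at this
    exact nonneg_of_mul_nonneg_right this (Real.exp_pos _)
  · rw [← h1, ofReal_integral_eq_lintegral_ofReal]
    · simp only [mul_left_comm _ Z⁻¹]
      rw [hpi]
      exact hi.const_mul _
    · exact ae_restrict_of_forall_mem hms hnn

/-- By symmetry `y` may be sorted; at a repeated entry the Vandermonde factor vanishes. -/
theorem IsPolynomialEnsemble.density_extendFun_nonneg {n : ℕ} {f : Fin n → ℝ → ℝ} {Z : ℝ}
    (hf : IsPolynomialEnsemble f Z) {a : ℝ} (ha : 0 < a) (y : Fin (n + 1) → ℝ) :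
    0 ≤ density (extendFun f) (a * Z) y := by
  by_cases hy : Function.Injective y
  · rw [← isSymmFun_density _ _ (Tuple.sort y) y]
    have hs : StrictMono (y ∘ Tuple.sort y) :=
      (Tuple.monotone_sort y).strictMono_of_injective (hy.comp (Tuple.sort y).injective)
    have h := (hf.setLIntegral_interlace hs).1
    rw [density, mul_inv, mul_right_comm, mul_assoc a⁻¹]
    exact mul_nonneg (mul_nonneg (inv_pos.2 ha).le h) (det_vandermonde_pos hs).le
  · have h0 : (Matrix.vandermonde y).det = 0 := by
      by_contra h
      exact hy (Matrix.det_vandermonde_ne_zero_iff.1 h)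
    rw [density, h0, mul_zero, zero_mul]

/-! ### Moments of the new functions -/

theorem integrable_pow_mul_exp_neg_sq_div_two (j : ℕ) :
    Integrable fun y : ℝ => y ^ j * Real.exp (-y ^ 2 / 2) := by
  have h := integrable_rpow_mul_exp_neg_mul_sq (b := 1 / 2) (by norm_num) (s := j)
    (by linarith [(Nat.cast_nonneg j : (0 : ℝ) ≤ j)])
  refine h.congr (Filter.Eventually.of_forall fun y => ?_)
  simp only [Real.rpow_natCast]
  congr 2
  ring

/-- With `y = a + t` the weight splits as `exp (-a² / 2) exp (-a t) exp (-t² / 2)`. The worst term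
`a ^ (m + 1) * exp (-a t)` integrates to `a ^ m`. This gain of one power allows `j` up to `m + 1`.
-/
theorem exists_setLIntegral_Ioi_pow_mul_exp_le (m : ℕ) : ∃ C : ℝ, 0 ≤ C ∧ ∀ j ≤ m + 1, ∀ a > 0,
    ∫⁻ y in Set.Ioi a, ENNReal.ofReal (y ^ j * Real.exp (-y ^ 2 / 2)) ≤
      ENNReal.ofReal (C * (1 + a ^ m) * Real.exp (-a ^ 2 / 2)) := by
  set A : ℝ → ℝ := fun t => (1 + 2 ^ m * t ^ (m + 1)) * Real.exp (-t ^ 2 / 2) with hA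
  have hAi : Integrable A := by
    have h0 := integrable_pow_mul_exp_neg_sq_div_two 0
    have h1 := (integrable_pow_mul_exp_neg_sq_div_two (m + 1)).const_mul (2 ^ m)
    refine (h0.add h1).congr (Filter.Eventually.of_forall fun t => ?_)
    simp only [hA, Pi.add_apply]
    ring
  have hA0 : 0 ≤ ∫ t in Set.Ioi 0, A t := setIntegral_nonneg measurableSet_Ioi fun t ht => by
    have : 0 < t := ht
    positivity
  refine ⟨(∫ t in Set.Ioi 0, A t) + 2 ^ m, by positivity, fun j hj a ha => ?_⟩
  have hemb : MeasurableEmbedding fun t : ℝ => a + t := (MeasurableEquiv.addLeft a).measurableEmbedding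
  have hpre : (fun t : ℝ => a + t) ⁻¹' Set.Ioi a = Set.Ioi 0 := by ext t; simp
  rw [← (measurePreserving_add_left volume a).setLIntegral_comp_preimage_emb hemb, hpre]
  -- The dominating function: `A` collects the terms bounded with `exp (-a t) ≤ 1`, and the term in
  -- `a ^ (m + 1)` keeps its exponential in `a t` to be integrated exactly.
  set G : ℝ → ℝ := fun t => Real.exp (-a ^ 2 / 2) * (A t + 2 ^ m * a ^ m * (a * Real.exp (-a * t)))
    with hG
  have hGi : IntegrableOn G (Set.Ioi 0) :=
    (hAi.integrableOn.add (((integrableOn_exp_mul_Ioi (neg_neg_of_pos ha) 0).const_mul a).const_mul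
      _)).const_mul _
  have hG0 : ∀ t ∈ Set.Ioi (0 : ℝ), 0 ≤ G t := fun t ht => by
    have : 0 < t := ht
    positivity
  have hGint : ∫ t in Set.Ioi 0, G t =
      Real.exp (-a ^ 2 / 2) * ((∫ t in Set.Ioi 0, A t) + 2 ^ m * a ^ m) := by
    rw [hG, integral_const_mul, integral_add hAi.integrableOn
      (((integrableOn_exp_mul_Ioi (neg_neg_of_pos ha) 0).const_mul a).const_mul _),
      integral_const_mul, integral_const_mul, integral_exp_mul_Ioi (neg_neg_of_pos ha)]
    simp only [mul_zero, Real.exp_zero]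
    field_simp
  have hle : ∀ t ∈ Set.Ioi (0 : ℝ), (a + t) ^ j * Real.exp (-(a + t) ^ 2 / 2) ≤ G t := by
    intro t ht
    have ht : 0 < t := ht
    have h1 : (a + t) ^ j ≤ 1 + 2 ^ m * (a ^ (m + 1) + t ^ (m + 1)) := by
      have h2 : (a + t) ^ j ≤ 1 + (a + t) ^ (m + 1) := by
        rcases le_total (a + t) 1 with h | h
        · have := pow_le_one₀ (n := j) (by positivity : 0 ≤ a + t) h
          have : 0 ≤ (a + t) ^ (m + 1) := by positivity
          linarith
        · have := pow_le_pow_right₀ h hj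
          linarith
      have h3 := add_pow_le ha.le ht.le (m + 1)
      rw [Nat.add_sub_cancel] at h3
      linarith
    have h4 : Real.exp (-(a + t) ^ 2 / 2) =
        Real.exp (-a ^ 2 / 2) * (Real.exp (-a * t) * Real.exp (-t ^ 2 / 2)) := by
      rw [← Real.exp_add, ← Real.exp_add]
      congr 1
      ring
    have h5 : Real.exp (-a * t) ≤ 1 := Real.exp_le_one_iff.2 (by nlinarith)
    have h6 : Real.exp (-t ^ 2 / 2) ≤ 1 := Real.exp_le_one_iff.2 (by nlinarith [sq_nonneg t])
    have h7 := Real.exp_pos (-a * t)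
    have h8 := Real.exp_pos (-t ^ 2 / 2)
    rw [h4, mul_left_comm]
    refine mul_le_mul_of_nonneg_left ?_ (Real.exp_pos _).le
    calc (a + t) ^ j * (Real.exp (-a * t) * Real.exp (-t ^ 2 / 2))
        ≤ (1 + 2 ^ m * (a ^ (m + 1) + t ^ (m + 1))) *
            (Real.exp (-a * t) * Real.exp (-t ^ 2 / 2)) := by gcongr
      _ = (1 + 2 ^ m * t ^ (m + 1)) * Real.exp (-t ^ 2 / 2) * Real.exp (-a * t) +
          2 ^ m * a ^ m * (a * Real.exp (-a * t)) * Real.exp (-t ^ 2 / 2) := by ring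
      _ ≤ A t * 1 + 2 ^ m * a ^ m * (a * Real.exp (-a * t)) * 1 := by
          gcongr
      _ = _ := by ring
  calc ∫⁻ t in Set.Ioi 0, ENNReal.ofReal ((a + t) ^ j * Real.exp (-(a + t) ^ 2 / 2))
      ≤ ∫⁻ t in Set.Ioi 0, ENNReal.ofReal (G t) :=
        setLIntegral_mono' measurableSet_Ioi fun t ht => ENNReal.ofReal_le_ofReal (hle t ht)
    _ = ENNReal.ofReal (∫ t in Set.Ioi 0, G t) :=
        (ofReal_integral_eq_lintegral_ofReal hGi (ae_restrict_of_forall_mem measurableSet_Ioi hG0)).symm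
    _ ≤ _ := by
        rw [hGint]
        apply ENNReal.ofReal_le_ofReal
        rw [mul_comm]
        refine mul_le_mul_of_nonneg_right ?_ (Real.exp_pos _).le
        have h1 : 0 ≤ (∫ t in Set.Ioi 0, A t) * a ^ m := by positivity
        have h2 : (0 : ℝ) ≤ 2 ^ m := by positivity
        linarith

/-- Tonelli over `0 < x < y` moves the `y` integral inside, where the tail bound yields `exp (-x² /
2)`. This cancels the growing weight and leaves a multiple of `(1 + x ^ m) * |f x|`. -/
theorem integrableOn_Ioi_moment {f : ℝ → ℝ} {m j : ℕ} (hj : j ≤ m + 1) (hf : Integrable f)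
    (hfm : Integrable fun x => x ^ m * f x) :
    IntegrableOn (fun y => y ^ j * (Real.exp (-y ^ 2 / 2) *
      ∫ x in (0 : ℝ)..y, Real.exp (x ^ 2 / 2) * f x)) (Set.Ioi 0) := by
  have hw : ∀ a b, IntervalIntegrable (fun x => Real.exp (x ^ 2 / 2) * f x) volume a b := fun a b =>
    hf.intervalIntegrable.continuousOn_mul (by fun_prop)
  have hcont : Continuous fun y => y ^ j * (Real.exp (-y ^ 2 / 2) *
      ∫ x in (0 : ℝ)..y, Real.exp (x ^ 2 / 2) * f x) :=
    (continuous_pow j).mul ((by fun_prop : Continuous fun y : ℝ => Real.exp (-y ^ 2 / 2)).mul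
      (intervalIntegral.continuous_primitive hw 0))
  refine ⟨hcont.aestronglyMeasurable, ?_⟩
  obtain ⟨C, hC, htail⟩ := exists_setLIntegral_Ioi_pow_mul_exp_le m
  set W : ℝ → ENNReal := fun x => ‖Real.exp (x ^ 2 / 2) * f x‖ₑ with hW
  set E : ℝ → ENNReal := fun y => ENNReal.ofReal (y ^ j * Real.exp (-y ^ 2 / 2)) with hE
  have hWm : AEMeasurable W volume :=
    ((by fun_prop : Continuous fun x : ℝ => Real.exp (x ^ 2 / 2)).aestronglyMeasurable.mul
      hf.aestronglyMeasurable).enorm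
  have hEm : Measurable E := by fun_prop
  have h1 : ∀ y ∈ Set.Ioi (0 : ℝ), ‖y ^ j * (Real.exp (-y ^ 2 / 2) *
      ∫ x in (0 : ℝ)..y, Real.exp (x ^ 2 / 2) * f x)‖ₑ ≤
      ∫⁻ x in Set.Ioi 0, {p : ℝ × ℝ | p.1 < p.2}.indicator (fun p => W p.1 * E p.2) (x, y) := by
    intro y hy
    have hy : 0 < y := hy
    have h2 : ‖∫ x in (0 : ℝ)..y, Real.exp (x ^ 2 / 2) * f x‖ₑ ≤ ∫⁻ x in Set.Ioo 0 y, W x := by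
      rw [intervalIntegral.integral_of_le hy.le, integral_Ioc_eq_integral_Ioo]
      exact enorm_integral_le_lintegral_enorm _
    have h3 : ‖y ^ j * Real.exp (-y ^ 2 / 2)‖ₑ = E y := by
      rw [Real.enorm_of_nonneg (by positivity)]
    rw [← mul_assoc, enorm_mul, h3]
    calc E y * _ ≤ E y * ∫⁻ x in Set.Ioo 0 y, W x := by gcongr
      _ = ∫⁻ x in Set.Ioo 0 y, W x * E y := by
          rw [lintegral_mul_const' _ _ ENNReal.ofReal_ne_top, mul_comm]
      _ = _ := by
          rw [← lintegral_indicator measurableSet_Ioo, ← lintegral_indicator measurableSet_Ioi]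
          refine lintegral_congr fun x => ?_
          simp only [Set.indicator, Set.mem_Ioo, Set.mem_Ioi, Set.mem_ofPred_eq]
          split_ifs <;> tauto
  have hlt : MeasurableSet {p : ℝ × ℝ | p.1 < p.2} := measurableSet_lt measurable_fst measurable_snd
  have hKm : AEMeasurable ({p : ℝ × ℝ | p.1 < p.2}.indicator (fun p => W p.1 * E p.2))
      ((volume.restrict (Set.Ioi 0)).prod (volume.restrict (Set.Ioi 0))) := by
    refine AEMeasurable.indicator (AEMeasurable.mul ?_ (hEm.comp measurable_snd).aemeasurable) hlt
    exact hWm.restrict.comp_fst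
  have hKm' : AEMeasurable (Function.uncurry fun y x =>
      {p : ℝ × ℝ | p.1 < p.2}.indicator (fun p => W p.1 * E p.2) (x, y))
      ((volume.restrict (Set.Ioi 0)).prod (volume.restrict (Set.Ioi 0))) := hKm.prod_swap
  have hint : Integrable fun x => C * ((1 + |x| ^ m) * ‖f x‖) := by
    refine Integrable.const_mul ?_ C
    refine (hf.norm.add hfm.norm).congr (Filter.Eventually.of_forall fun x => ?_)
    simp only [Pi.add_apply, norm_mul, norm_pow, Real.norm_eq_abs]
    ring
  calc ∫⁻ y in Set.Ioi 0, ‖y ^ j * (Real.exp (-y ^ 2 / 2) *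
        ∫ x in (0 : ℝ)..y, Real.exp (x ^ 2 / 2) * f x)‖ₑ
      ≤ ∫⁻ y in Set.Ioi 0, ∫⁻ x in Set.Ioi 0,
          {p : ℝ × ℝ | p.1 < p.2}.indicator (fun p => W p.1 * E p.2) (x, y) :=
        setLIntegral_mono' measurableSet_Ioi h1
    _ = ∫⁻ x in Set.Ioi 0, ∫⁻ y in Set.Ioi 0,
          {p : ℝ × ℝ | p.1 < p.2}.indicator (fun p => W p.1 * E p.2) (x, y) :=
        lintegral_lintegral_swap hKm'
    _ ≤ ∫⁻ x in Set.Ioi 0, ENNReal.ofReal (C * ((1 + |x| ^ m) * ‖f x‖)) := by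
        refine setLIntegral_mono' measurableSet_Ioi fun x hx => ?_
        have hx : 0 < x := hx
        have h4 : ∫⁻ y in Set.Ioi 0,
            {p : ℝ × ℝ | p.1 < p.2}.indicator (fun p => W p.1 * E p.2) (x, y) =
            W x * ∫⁻ y in Set.Ioi x, E y := by
          rw [← lintegral_const_mul _ hEm, ← lintegral_indicator measurableSet_Ioi,
            ← lintegral_indicator measurableSet_Ioi]
          refine lintegral_congr fun y => ?_
          simp only [Set.indicator, Set.mem_Ioi, Set.mem_ofPred_eq]
          split_ifs <;> first | rfl | (exfalso; linarith)
        rw [h4]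
        have h5 : W x = ENNReal.ofReal (Real.exp (x ^ 2 / 2) * ‖f x‖) := by
          simp only [hW]
          rw [← ofReal_norm, norm_mul, Real.norm_of_nonneg (Real.exp_pos _).le]
        calc W x * ∫⁻ y in Set.Ioi x, E y
            ≤ W x * ENNReal.ofReal (C * (1 + x ^ m) * Real.exp (-x ^ 2 / 2)) := by
              gcongr
              exact htail j hj x hx
          _ = _ := by
              rw [h5, ← ENNReal.ofReal_mul (by positivity), abs_of_pos hx]
              congr 1
              have : Real.exp (x ^ 2 / 2) * Real.exp (-x ^ 2 / 2) = 1 := by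
                rw [← Real.exp_add]; simp [neg_div]
              calc _ = C * ((1 + x ^ m) * ‖f x‖) *
                  (Real.exp (x ^ 2 / 2) * Real.exp (-x ^ 2 / 2)) := by ring
                _ = _ := by rw [this, mul_one]
    _ ≤ ∫⁻ x, ENNReal.ofReal (C * ((1 + |x| ^ m) * ‖f x‖)) := setLIntegral_le_lintegral _ _
    _ < ⊤ := hint.lintegral_lt_top

theorem integrable_moment_primitive {f : ℝ → ℝ} {m j : ℕ} (hj : j ≤ m + 1) (hf : Integrable f)
    (hfm : Integrable fun x => x ^ m * f x) :
    Integrable (fun y => y ^ j * (Real.exp (-y ^ 2 / 2) *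
      ∫ x in (0 : ℝ)..y, Real.exp (x ^ 2 / 2) * f x)) := by
  have h1 := integrableOn_Ioi_moment hj hf hfm
  have h2 := integrableOn_Ioi_moment (f := fun x => f (-x)) hj hf.comp_neg (by
    refine (hfm.comp_neg.const_mul ((-1) ^ m)).congr (Filter.Eventually.of_forall fun x => ?_)
    simp only [neg_pow x, ← mul_assoc, ← mul_pow]
    norm_num)
  rw [← integrableOn_univ, ← Set.Iic_union_Ioi (a := (0 : ℝ))]
  refine IntegrableOn.union ?_ h1
  rw [integrableOn_Iic_iff_integrableOn_Iio]
  have h3 : IntegrableOn (fun y => (fun y => y ^ j * (Real.exp (-y ^ 2 / 2) *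
      ∫ x in (0 : ℝ)..y, Real.exp (x ^ 2 / 2) * f x)) (-y)) (Set.Ioi 0) := by
    -- Reflection gives `(-1) ^ j` from the power and one more sign from the orientation of the
    -- integral.
    refine IntegrableOn.congr_fun (h2.const_mul ((-1) ^ (j + 1))) (fun y _ => ?_) measurableSet_Ioi
    have := intervalIntegral.integral_comp_neg (a := 0) (b := y)
      (fun x => Real.exp (x ^ 2 / 2) * f x)
    simp only [neg_sq, neg_zero] at this ⊢
    rw [this, intervalIntegral.integral_symm, neg_pow y]
    ring
  have h4 := (Measure.measurePreserving_neg (volume : Measure ℝ)).integrableOn_comp_preimage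
    (Homeomorph.neg ℝ).measurableEmbedding (s := Set.Iio 0) (f := fun y => y ^ j * (Real.exp (-y ^ 2 / 2) *
      ∫ x in (0 : ℝ)..y, Real.exp (x ^ 2 / 2) * f x))
  apply h4.1
  have h5 : (Neg.neg ⁻¹' Set.Iio 0 : Set ℝ) = Set.Ioi 0 := by
    ext t; simp
  rw [h5]
  exact h3

theorem IsPolynomialEnsemble.integrable_moment_extendFun {n : ℕ} {f : Fin n → ℝ → ℝ} {Z : ℝ}
    (hf : IsPolynomialEnsemble f Z) (j k : Fin (n + 1)) :
    Integrable fun y => y ^ (j : ℕ) * extendFun f k y := by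
  refine Fin.cases ?_ (fun k => ?_) k
  · simpa [extendFun] using integrable_pow_mul_exp_neg_sq_div_two j
  · simp only [extendFun, Fin.cons_succ]
    have hn : 0 < n := k.pos
    -- The functions `f k` have moments up to order `n - 1`, while order `n` is needed for the
    -- larger ensemble: the extra power of the tail bound is used in full.
    exact integrable_moment_primitive (m := n - 1) (by omega) (hf.integrable k)
      (hf.integrable_moment ⟨n - 1, by omega⟩ k)

/-! ### Assembly: the density of the bordered eigenvalues -/

theorem continuous_extendFun {n : ℕ} {f : Fin n → ℝ → ℝ} {Z : ℝ} (hf : IsPolynomialEnsemble f Z)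
    (k : Fin (n + 1)) : Continuous (extendFun f k) := by
  refine Fin.cases ?_ (fun k => ?_) k
  · simp only [extendFun, Fin.cons_zero]
    fun_prop
  · simp only [extendFun, Fin.cons_succ]
    exact (by fun_prop : Continuous fun y : ℝ => Real.exp (-y ^ 2 / 2)).mul
      (intervalIntegral.continuous_primitive (hf.intervalIntegrable k) 0)

theorem continuous_det_vandermonde (n : ℕ) :
    Continuous fun x : Fin n → ℝ => (Matrix.vandermonde x).det := by
  simp only [Matrix.det_vandermonde]
  fun_prop

theorem continuous_density_extendFun {n : ℕ} {f : Fin n → ℝ → ℝ} {Z : ℝ}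
    (hf : IsPolynomialEnsemble f Z) (W : ℝ) : Continuous (density (extendFun f) W) := by
  refine (continuous_const.mul (continuous_det_vandermonde _)).mul (Continuous.matrix_det ?_)
  exact continuous_pi fun j => continuous_pi fun k =>
    (continuous_extendFun hf k).comp (continuous_apply j)

theorem IsPolynomialEnsemble.aemeasurable_det {n : ℕ} {f : Fin n → ℝ → ℝ} {Z : ℝ}
    (hf : IsPolynomialEnsemble f Z) :
    AEMeasurable fun x : Fin n → ℝ => (Matrix.of fun j k : Fin n => f k (x j)).det := by
  simp only [Matrix.det_apply]
  refine Finset.aemeasurable_fun_sum _ fun σ _ => AEMeasurable.const_smul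
    (Finset.aemeasurable_fun_prod _ fun j _ => ?_) _
  exact (hf.integrable j).aestronglyMeasurable.aemeasurable.comp_quasiMeasurePreserving
    (Measure.quasiMeasurePreserving_eval (fun _ : Fin n => volume) (σ j))

theorem density_mul_kernel {n : ℕ} {f : Fin n → ℝ → ℝ} {Z : ℝ} (hf : IsPolynomialEnsemble f Z)
    {x : Fin n → ℝ} {y : Fin (n + 1) → ℝ} (h : Interlace x y) :
    ENNReal.ofReal (density f Z x) * ENNReal.ofReal
        ((Matrix.vandermonde y).det / (Matrix.vandermonde x).det *
          Real.exp (-(∑ k, y k ^ 2) / 2 + (∑ j, x j ^ 2) / 2)) =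
      ENNReal.ofReal (Real.exp ((∑ j, x j ^ 2) / 2) *
        (Z⁻¹ * (Matrix.of fun j k : Fin n => f k (x j)).det)) *
      ENNReal.ofReal ((Matrix.vandermonde y).det * Real.exp (-(∑ k, y k ^ 2) / 2)) := by
  have hx := det_vandermonde_pos h.strictMono_left
  rw [← ENNReal.ofReal_mul (hf.nonneg x), ← ENNReal.ofReal_mul
    (mul_nonneg (Real.exp_pos _).le (hf.inv_mul_det_nonneg h.strictMono_left)), density,
    Real.exp_add]
  congr 1
  field_simp

/-- On increasing tuples the two sides are the iterated integrals of one nonnegative kernel in the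
two orders. The chambers number `n!` for `x` and `(n + 1)!` for `y`, whence the factor `n + 1`; the
factor `√(2π)` normalises the corner entry. -/
theorem IsPolynomialEnsemble.lintegral_borderMean {n : ℕ} {f : Fin n → ℝ → ℝ} {Z : ℝ}
    (hf : IsPolynomialEnsemble f Z) {φ : (Fin (n + 1) → ℝ) → ENNReal} (hφ : IsSymmFun φ)
    (hm : Measurable φ) :
    ∫⁻ x, borderMean φ x ∂(volume.withDensity fun x => ENNReal.ofReal (density f Z x)) =
      ∫⁻ y, φ y ∂(volume.withDensity fun y =>
        ENNReal.ofReal (density (extendFun f) ((n + 1) * √(2 * Real.pi) * Z) y)) := by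
  set c : ENNReal := ENNReal.ofReal (√(2 * Real.pi))⁻¹ with hc
  have hc_top : c ≠ ⊤ := ENNReal.ofReal_ne_top
  set g : (Fin n → ℝ) → ENNReal := fun x => ENNReal.ofReal (Real.exp ((∑ j, x j ^ 2) / 2) *
        (Z⁻¹ * (Matrix.of fun j k : Fin n => f k (x j)).det)) with hg
  set q : (Fin (n + 1) → ℝ) → ENNReal := fun y =>
    ENNReal.ofReal ((Matrix.vandermonde y).det * Real.exp (-(∑ k, y k ^ 2) / 2)) with hq
  have hdens : AEMeasurable (fun x : Fin n → ℝ => ENNReal.ofReal (density f Z x)) :=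
    (((continuous_det_vandermonde n).measurable.const_mul _).aemeasurable.mul
      hf.aemeasurable_det).ennreal_ofReal
  have hgm : AEMeasurable g :=
    ((by fun_prop : Measurable fun x : Fin n → ℝ => Real.exp ((∑ j, x j ^ 2) / 2)).aemeasurable.mul
      (hf.aemeasurable_det.const_mul _)).ennreal_ofReal
  have hqm : Measurable q := ((continuous_det_vandermonde _).measurable.mul
    (by fun_prop : Measurable fun y : Fin (n + 1) → ℝ =>
      Real.exp (-(∑ k, y k ^ 2) / 2))).ennreal_ofReal
  have hI : MeasurableSet {p : (Fin n → ℝ) × (Fin (n + 1) → ℝ) | Interlace p.1 p.2} := by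
    simp only [Interlace, Set.ofPred_forall]
    refine MeasurableSet.iInter fun j => MeasurableSet.inter ?_ ?_
    · exact measurableSet_lt ((measurable_pi_apply _).comp measurable_snd)
        ((measurable_pi_apply _).comp measurable_fst)
    · exact measurableSet_lt ((measurable_pi_apply _).comp measurable_fst)
        ((measurable_pi_apply _).comp measurable_snd)
  -- Extension by zero off the interlacing pairs lets both variables run over the whole space, so
  -- that Tonelli applies directly.
  set K : (Fin n → ℝ) → (Fin (n + 1) → ℝ) → ENNReal := fun x y =>
    {p : (Fin n → ℝ) × (Fin (n + 1) → ℝ) | Interlace p.1 p.2}.indicator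
      (fun p => g p.1 * (φ p.2 * q p.2)) (x, y) with hK
  have hKm : AEMeasurable (Function.uncurry K) (volume.prod volume) :=
    (hgm.comp_fst.mul ((hm.mul hqm).comp measurable_snd).aemeasurable).indicator hI
  have hsymm : IsSymmFun fun x : Fin n → ℝ => ENNReal.ofReal (density f Z x) * borderMean φ x :=
    fun σ x => by
      simp only [isSymmFun_density f Z σ x, isSymmFun_borderMean hφ hm σ x]
  have hsymm' : IsSymmFun fun y : Fin (n + 1) → ℝ =>
      ENNReal.ofReal (density (extendFun f) ((n + 1) * √(2 * Real.pi) * Z) y) * φ y := fun σ y => by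
    simp only [isSymmFun_density (extendFun f) _ σ y, hφ σ y]
  have hK1 : ∀ x y, Interlace x y → K x y = g x * (φ y * q y) := fun x y h =>
    Set.indicator_of_mem
      (show (x, y) ∈ {p : (Fin n → ℝ) × (Fin (n + 1) → ℝ) | Interlace p.1 p.2} from h) _
  have hK0 : ∀ x y, ¬ Interlace x y → K x y = 0 := fun x y h =>
    Set.indicator_of_notMem
      (show (x, y) ∉ {p : (Fin n → ℝ) × (Fin (n + 1) → ℝ) | Interlace p.1 p.2} from h) _
  have hleft : ∀ x ∈ {x : Fin n → ℝ | StrictMono x},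
      ENNReal.ofReal (density f Z x) * borderMean φ x = c * ∫⁻ y, K x y := by
    intro x hx
    rw [borderMean_eq hφ hm hx, mul_left_comm, ← lintegral_const_mul' _ _ ENNReal.ofReal_ne_top,
      ← lintegral_indicator (measurableSet_interlace x)]
    congr 1
    refine lintegral_congr fun y => ?_
    by_cases h : Interlace x y
    · rw [Set.indicator_of_mem (show y ∈ {y | Interlace x y} from h), hK1 x y h,
        mul_left_comm, density_mul_kernel hf h]
      simp only [hg, hq]
      ring
    · rw [Set.indicator_of_notMem (show y ∉ {y | Interlace x y} from h), hK0 x y h]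
  have hzero : ∀ x ∉ {x : Fin n → ℝ | StrictMono x}, ∫⁻ y, K x y = 0 := by
    intro x hx
    rw [← lintegral_zero (μ := (volume : Measure (Fin (n + 1) → ℝ)))]
    refine lintegral_congr fun y => Set.indicator_of_notMem (fun h => hx ?_) _
    exact Interlace.strictMono_left (show Interlace x y from h)
  have hright : ∀ y, ∫⁻ x, K x y = {y : Fin (n + 1) → ℝ | StrictMono y}.indicator
      (fun y => φ y * ENNReal.ofReal ((Matrix.vandermonde y).det *
        (Z⁻¹ * (Matrix.of fun j k : Fin (n + 1) => extendFun f k (y j)).det))) y := by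
    intro y
    by_cases hy : StrictMono y
    · obtain ⟨hnn, heq⟩ := hf.setLIntegral_interlace hy
      have hms : MeasurableSet {x : Fin n → ℝ | Interlace x y} := by
        rw [setOf_interlace_left]
        exact MeasurableSet.univ_pi fun _ => measurableSet_Ioo
      have h1 : ∀ x, K x y = {x : Fin n → ℝ | Interlace x y}.indicator g x * (φ y * q y) := by
        intro x
        by_cases h : Interlace x y
        · rw [Set.indicator_of_mem (show x ∈ {x | Interlace x y} from h), hK1 x y h]
        · rw [Set.indicator_of_notMem (show x ∉ {x | Interlace x y} from h), hK0 x y h,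
            zero_mul]
      rw [Set.indicator_of_mem (show y ∈ {y : Fin (n + 1) → ℝ | StrictMono y} from hy)]
      simp only [h1]
      rw [lintegral_mul_const'' _ (hgm.indicator hms), lintegral_indicator hms, heq, mul_left_comm,
        ← ENNReal.ofReal_mul (mul_nonneg (Real.exp_pos _).le hnn)]
      congr 2
      have : Real.exp ((∑ j, y j ^ 2) / 2) * Real.exp (-(∑ j, y j ^ 2) / 2) = 1 := by
        rw [← Real.exp_add]; simp [neg_div]
      calc _ = (Matrix.vandermonde y).det *
            (Z⁻¹ * (Matrix.of fun j k : Fin (n + 1) => extendFun f k (y j)).det) *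
          (Real.exp ((∑ j, y j ^ 2) / 2) * Real.exp (-(∑ j, y j ^ 2) / 2)) := by ring
        _ = _ := by rw [this, mul_one]
    · rw [Set.indicator_of_notMem (show y ∉ {y : Fin (n + 1) → ℝ | StrictMono y} from hy),
        ← lintegral_zero (μ := (volume : Measure (Fin n → ℝ)))]
      refine lintegral_congr fun x => Set.indicator_of_notMem (fun h => hy ?_) _
      exact Interlace.strictMono_right (show Interlace x y from h)
  have hset : ∫⁻ x in {x : Fin n → ℝ | StrictMono x}, ∫⁻ y, K x y = ∫⁻ x, ∫⁻ y, K x y := by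
    rw [← lintegral_indicator (measurableSet_strictMono n)]
    refine lintegral_congr fun x => ?_
    by_cases hx : x ∈ {x : Fin n → ℝ | StrictMono x}
    · rw [Set.indicator_of_mem hx]
    · rw [Set.indicator_of_notMem hx, hzero x hx]
  rw [lintegral_withDensity_eq_lintegral_mul₀ hdens (measurable_borderMean hm).aemeasurable,
    lintegral_withDensity_eq_lintegral_mul₀
      (continuous_density_extendFun hf _).measurable.ennreal_ofReal.aemeasurable hm.aemeasurable]
  simp only [Pi.mul_apply]
  rw [lintegral_eq_factorial_mul hsymm, lintegral_eq_factorial_mul hsymm',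
    setLIntegral_congr_fun (measurableSet_strictMono n) hleft,
    lintegral_const_mul' _ _ hc_top, hset,
    lintegral_lintegral_swap hKm]
  simp only [hright]
  rw [lintegral_indicator (measurableSet_strictMono _), Nat.factorial_succ, Nat.cast_mul, mul_comm
    ((n + 1 : ℕ) : ENNReal), mul_assoc, ← lintegral_const_mul' _ _ hc_top,
    ← lintegral_const_mul' _ _ (ENNReal.natCast_ne_top (n + 1))]
  congr 1
  refine setLIntegral_congr_fun (measurableSet_strictMono _) fun y hy => ?_
  have hn : ((n + 1 : ℕ) : ENNReal) = ENNReal.ofReal (n + 1) := by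
    rw [← Nat.cast_succ, ENNReal.ofReal_natCast]
  rw [hn, hc, mul_left_comm, mul_comm (φ y), ← mul_assoc (ENNReal.ofReal ((n : ℝ) + 1)),
    ← ENNReal.ofReal_mul (by positivity), ← ENNReal.ofReal_mul (by positivity), density]
  congr 2
  have h2 : (0 : ℝ) < √(2 * Real.pi) := by positivity
  have h3 : (0 : ℝ) < n + 1 := by positivity
  field_simp

theorem eigenvalueLaw_univ {Ω : Type*} [MeasurableSpace Ω] {μ : Measure Ω} [IsProbabilityMeasure μ]
    {n : ℕ} {M : Ω → Matrix (Fin n) (Fin n) ℂ} {hM : ∀ ω, (M ω).IsHermitian}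
    (hm : AEMeasurable (fun ω => (hM ω).eigenvalues) μ) :
    eigenvalueLaw μ M hM Set.univ = 1 := by
  have := lintegral_eigenvalueLaw (hM := hM) hm (φ := fun _ => 1) (fun _ _ => rfl) measurable_const
  simpa using this

theorem withDensity_density_map_comp_perm {n : ℕ} {f : Fin n → ℝ → ℝ} {Z : ℝ}
    (hm : Measurable (density f Z)) (τ : Equiv.Perm (Fin n)) :
    (volume.withDensity fun x => ENNReal.ofReal (density f Z x)).map (fun x => x ∘ τ) =
      volume.withDensity fun x => ENNReal.ofReal (density f Z x) := by
  have hp : MeasurePreserving (fun x : Fin n → ℝ => x ∘ τ) volume volume :=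
    measurePreserving_comp_perm volume τ
  refine Measure.ext_of_lintegral _ fun ψ hψ => ?_
  have hψτ : Measurable fun x : Fin n → ℝ => ψ (x ∘ τ) := hψ.comp hp.measurable
  rw [lintegral_map hψ hp.measurable, lintegral_withDensity_eq_lintegral_mul _ hm.ennreal_ofReal
    hψτ, lintegral_withDensity_eq_lintegral_mul _ hm.ennreal_ofReal hψ,
    ← hp.lintegral_comp (hm.ennreal_ofReal.mul hψ)]
  refine lintegral_congr fun x => ?_
  simp only [Pi.mul_apply]
  rw [isSymmFun_density f Z τ x]

end PolyEns

theorem proposition6p2 {Ω : Type*} [MeasurableSpace Ω] (μ : Measure Ω) [IsProbabilityMeasure μ]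
    (n : ℕ)
    (X : Ω → Matrix (Fin n) (Fin n) ℂ) (v : Ω → Fin n → ℂ) (c : Ω → ℝ)
    (f : Fin n → ℝ → ℝ)
    -- `X` is a random Hermitian matrix
    (hX : ∀ ω, (X ω).IsHermitian)
    (hXm : ∀ i j, Measurable (fun ω => X ω i j))
    -- `c`, `Re v_j`, `Im v_j` are mutually independent centred Gaussians
    (hc : HasLaw c (gaussianReal 0 1) μ)
    (hre : ∀ j, HasLaw (fun ω => (v ω j).re) (gaussianReal 0 (1 / 2)) μ)
    (him : ∀ j, HasLaw (fun ω => (v ω j).im) (gaussianReal 0 (1 / 2)) μ)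
    (hindep : iIndepFun (Sum.elim (fun _ : Unit => c)
      (Sum.elim (fun (j : Fin n) ω => (v ω j).re) (fun (j : Fin n) ω => (v ω j).im))) μ)
    -- `X` is independent of `(v, c)`
    (hXindep : IndepFun (fun ω (i j : Fin n) => X ω i j) (fun ω => (v ω, c ω)) μ)
    -- the eigenvalues of `X` are a polynomial ensemble with functions `f`
    (hf : PolyEns.EigenvaluesArePolynomialEnsemble μ X hX f) :
    PolyEns.EigenvaluesArePolynomialEnsemble μ
      (fun ω => PolyEns.extend (X ω) (v ω) (c ω))
      (fun ω => PolyEns.extend_isHermitian (hX ω) (v ω) (c ω))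
      (PolyEns.extendFun f) := by
  obtain ⟨Z, hZ, hlawX⟩ := hf
  obtain ⟨hvc, hlaw⟩ := PolyEns.map_prodMk_eq_complexGaussian hc hre him hindep
  have hYm := PolyEns.aemeasurable_eigenvalues_extend hX hXm hvc
  have ha : (0 : ℝ) < (n + 1) * √(2 * Real.pi) := by positivity
  have hcont := PolyEns.continuous_density_extendFun hZ ((n + 1) * √(2 * Real.pi) * Z)
  have hnn := hZ.density_extendFun_nonneg ha
  have hlawY : PolyEns.eigenvalueLaw μ (fun ω => PolyEns.extend (X ω) (v ω) (c ω))
      (fun ω => PolyEns.extend_isHermitian (hX ω) (v ω) (c ω)) = volume.withDensity fun y =>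
        ENNReal.ofReal (PolyEns.density (PolyEns.extendFun f) ((n + 1) * √(2 * Real.pi) * Z) y) := by
    refine PolyEns.measure_ext_of_isSymmFun (PolyEns.eigenvalueLaw_map_comp_perm hYm)
      (PolyEns.withDensity_density_map_comp_perm hcont.measurable) fun φ hφ hm => ?_
    rw [PolyEns.lintegral_eigenvalueLaw_extend hX hXm hvc hlaw hXindep hφ hm, hlawX,
      hZ.lintegral_borderMean hφ hm]
  refine ⟨_, ⟨hZ.integrable_moment_extendFun, hnn, ?_⟩, hlawY⟩
  -- The total mass is not computed: it is one because the density is that of a probability law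
  -- already identified.
  have h1 := PolyEns.eigenvalueLaw_univ hYm
  rw [hlawY, withDensity_apply _ MeasurableSet.univ, Measure.restrict_univ] at h1
  rw [integral_eq_lintegral_of_nonneg_ae (Filter.Eventually.of_forall hnn)
    hcont.aestronglyMeasurable, h1, ENNReal.toReal_one]
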